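/- Let $X=(X_1,\dots,X_k)$ be a random vector with values in a box $\mathcal X=[a_1,b_1]\times\cdots\times[a_k,b_k]$ (where $a_i=-\infty$ and $b_i=\infty$ are allowed) whose coordinates have continuous distribution functions, and let an i.i.d. sample of size $n$ of $X$ be given. Fix a depth $l\le k$ and non-negative integers $p$ and $p_{j_1\ldots j_i}$ (one for each multi-index with $1\le i\le l-1$, $0\le j_1\le p$, $0\le j_{2}\le p_{j_1}$, and so on); write $p_{\emptyset}=p$ and $A_{\emptyset}=\mathcal X$. *Partition.* For $i=1,\dots,l$, each region $A=A_{j_1\ldots j_{i-1}}$ of the previous step, containing $n(A)$ sample points, is split along the $i$-th coordinate into $q+1$ regions, $q=p_{j_1\ldots j_{i-1}}$: with $\tilde n_s=\lfloor n(A)\,s/(q+1)\rfloor$, and with $X_{(r)}$ the $r$-th smallest of the $i$-th coordinates of the sample points in $A$, put $c_s=X_{(\tilde n_s)}$ for $1\le s\le q$ (with $c_s=a_i$ if $\tilde n_s=0$), $c_0=a_i$, $c_{q+1}=b_i$, and $A_{j_1\ldots j_{i-1}s}=\{x\in A: c_s<x_i\le c_{s+1}\}$, $0\le s\le q$. The final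 regions are the $A_{\bm j}$, $\bm j=(j_1,\dots,j_l)$. *Risk.* Let $\hat m_{\bm j}=P(X\in A_{\bm j})$ be the true probability of the sample-dependent region $A_{\bm j}$ (the sample being held fixed, $X$ independent of it), let $m_{\bm j}=1/\bigl((p+1)(p_{j_1}+1)\cdots(p_{j_1\ldots j_{l-1}}+1)\bigr)$ be its equal-mass estimate, and $$D_f[m:\hat m]=\sum_{\bm j}m_{\bm j}\,f\!\left(\frac{\hat m_{\bm j}}{m_{\bm j}}\right),\qquad ED_P(n)=E\bigl[D_f[m:\hat m]\bigr],$$ where $f$ is convex on $(0,\infty)$ with $f(1)=f'(1)=0$ and $f''(1)=1$. **Theorem.** Suppose that $f^{(3)}$ exists on $(0,\infty)$ and is bounded on $[\epsilon,\infty)$ for every $\epsilon>0$, and that the risk is finite ($D_f[m:\hat m]$ is integrable) for arbitrarily large $n$. Then the risk $ED_P(n)$ is finite for all sufficiently large $n$, and $$ED_P(n)=\frac{p'}{2n}+o(n^{-1})\qquad(n\to\infty),$$ where $p'$ is the total number of the regions $A_{\bm j}$ minus one. -/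

import Mathlib

open MeasureTheory Filter Asymptotics

noncomputable section

namespace MovingRegion

/-- The box `[a₁, b₁] × ⋯ × [a_k, b_k]`; infinite end points are allowed. -/
def box {k : ℕ} (a b : Fin k → EReal) : Set (Fin k → ℝ) :=
  {y | ∀ i, a i ≤ (y i : EReal) ∧ (y i : EReal) ≤ b i}

/-- The indices of the sample points that belong to the region `A`. -/
def members {k n : ℕ} (x : Fin n → Fin k → ℝ) (A : Set (Fin k → ℝ)) : Finset (Fin n) :=
  open Classical in Finset.univ.filter fun τ => x τ ∈ A

/-- The `r`-th order statistic (`1 ≤ r ≤ S.card`, in ascending order) of the values `v τ`, `τ ∈ S`: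
the least `t` such that at least `r` of these values are `≤ t`. -/
def orderStat {n : ℕ} (v : Fin n → ℝ) (S : Finset (Fin n)) (r : ℕ) : ℝ :=
  sInf {t : ℝ | r ≤ (S.filter fun τ => v τ ≤ t).card}

/-- The `s`-th cut point (`s = 0, …, q + 1`) when the values `v τ`, `τ ∈ S`, are used to split
`(a, b]` into `q + 1` intervals: the order statistic of rank `⌊S.card * s / (q + 1)⌋`, where
rank `0` stands for the lower end point `a`, and the last cut point is the upper end point `b`. -/
def cutPoint {n : ℕ} (a b : EReal) (v : Fin n → ℝ) (S : Finset (Fin n)) (q s : ℕ) : EReal :=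
  if s = q + 1 then b
  else if S.card * s / (q + 1) = 0 then a
  else ((orderStat v S (S.card * s / (q + 1)) : ℝ) : EReal)

/-- The region `A_{j₁ … j_i}` made from the sample `x`. A multi-index `(j₁, …, j_i)` is stored as the
list `[j_i, …, j₁]`, latest index first, and the region with multi-index `J` is split, along the
first coordinate not used so far, into `p J + 1` regions. -/
def region {k n : ℕ} (a b : Fin k → EReal) (p : List ℕ → ℕ) (x : Fin n → Fin k → ℝ) :
    List ℕ → Set (Fin k → ℝ)
  | [] => box a b
  | s :: J => {y | y ∈ region a b p x J ∧ ∃ h : J.length < k,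
      (y ⟨J.length, h⟩ : EReal) ∈ Set.Ioc
        (cutPoint (a ⟨J.length, h⟩) (b ⟨J.length, h⟩) (fun τ => x τ ⟨J.length, h⟩)
          (members x (region a b p x J)) (p J) s)
        (cutPoint (a ⟨J.length, h⟩) (b ⟨J.length, h⟩) (fun τ => x τ ⟨J.length, h⟩)
          (members x (region a b p x J)) (p J) (s + 1))}

/-- All multi-indices `(j₁, …, j_l)` with `0 ≤ j_{i+1} ≤ p (j₁, …, j_i)` (latest index first). -/
def cells (p : List ℕ → ℕ) : ℕ → Finset (List ℕ)
  | 0 => {[]}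
  | l + 1 => (cells p l).biUnion fun J => (Finset.range (p J + 1)).image fun s => s :: J

/-- The equal-mass estimate `1 / ((p + 1) (p_{j₁} + 1) ⋯ (p_{j₁ … j_{i-1}} + 1))` of the probability
of the region `A_{j₁ … j_i}`. -/
def estMass (p : List ℕ → ℕ) : List ℕ → ℝ
  | [] => 1
  | _ :: J => estMass p J / ((p J : ℝ) + 1)

/-- The true probability `P(X ∈ A_J)` of the (sample-dependent) region, `X` having law `μ`. -/
def trueMass {k n : ℕ} (a b : Fin k → EReal) (p : List ℕ → ℕ) (μ : Measure (Fin k → ℝ))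
    (x : Fin n → Fin k → ℝ) (J : List ℕ) : ℝ :=
  μ.real (region a b p x J)

/-- The `f`-divergence `D_f[m : m'] = ∑ m_i f(m'_i / m_i)` between two discrete distributions. -/
def fDiv {ι : Type*} (f : ℝ → ℝ) (I : Finset ι) (m m' : ι → ℝ) : ℝ :=
  ∑ i ∈ I, m i * f (m' i / m i)

/-- The loss `D_f[m : m̂]` of the moving region method of depth `l`, for the sample `x`. -/
def loss {k n : ℕ} (f : ℝ → ℝ) (a b : Fin k → EReal) (p : List ℕ → ℕ) (l : ℕ)
    (μ : Measure (Fin k → ℝ)) (x : Fin n → Fin k → ℝ) : ℝ :=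
  fDiv f (cells p l) (estMass p) (trueMass a b p μ x)

/-- The joint law of an i.i.d. sample of size `n` from `μ`. -/
def sampleLaw {k : ℕ} (μ : Measure (Fin k → ℝ)) (n : ℕ) : Measure (Fin n → Fin k → ℝ) :=
  Measure.pi fun _ => μ

/-- The expected loss for samples of size `n`. -/
def risk {k : ℕ} (f : ℝ → ℝ) (a b : Fin k → EReal) (p : List ℕ → ℕ) (l : ℕ)
    (μ : Measure (Fin k → ℝ)) (n : ℕ) : ℝ :=
  ∫ x, loss f a b p l μ x ∂(sampleLaw μ n)

end MovingRegion

end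

namespace MovingRegion

/-! ### Order statistics -/

section OrderStat

variable {n : ℕ} (v : Fin n → ℝ) (S : Finset (Fin n)) (r : ℕ)

/-! The number of sample points in a region $A_J$ is essentially not random: the cuts are order
statistics of prescribed rank, so it equals $n m_J$ up to a rounding error at most the depth
(`abs_card_members_sub_le`). The true mass $\hat m_J$ therefore fluctuates only through the gap
between empirical and true mass of the random box $A_J$. To control this gap, $A_J$ is compared with
a deterministic cell $B_J$ (`popCell`) cut at quantiles of $\mu$, with $\mu(B_J)=m_J$. Uniform
concentration over boxes shows that $A_J$ and $B_J$ differ by mass about $n^{-7/16}$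
(`real_symmDiff_popCell_le`). Concentration restricted to boxes that close to $B_J$ then shows that
both sets have nearly the same deviation. With $Y_J$ the number of sample points in $B_J$, this
gives $\hat m_J-m_J=-(Y_J/n-m_J)+O(n^{-10/16})$ off an event of probability $O(n^{-17/16})$
(`exists_good_event`). A Taylor expansion of $f$ at $1$ turns the loss into $\sum_J
(Y_J/n-m_J)^2/(2m_J)$. As $Y_J$ is binomial, the expectation is $\sum_J(1-m_J)/(2n)$, which is
$p'/(2n)$ because the $m_J$ sum to $1$. The remaining danger is a possible blow-up of $f$ at $0$.
Finite risk at one sample size $R$ already forces $f(u)\le Cu^{-R}$ on $(0,1)$: with probability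
$(um)^R$ the whole sample lies in a half space of mass $um$, and then some region has mass at most
$um$ (`exists_growth_bound`). On the other hand a region of mass at most $t$ is a small box holding
about $nm$ points, which has probability at most $K2^{-n}t^{R+1}$ for small $t$
(`exists_lower_tail_bound`). Hence the negative moment of order $R$ near $0$ is exponentially small,
which gives both integrability and the error term (`cell_asymptotics`). -/

theorem isClosed_orderStat_set : IsClosed {t : ℝ | r ≤ (S.filter fun τ => v τ ≤ t).card} := by
  -- At least $r$ values lie below $t$ exactly when some index set of size at least $r$ does: a
  -- finite union of finite intersections of closed rays.
  have h : {t : ℝ | r ≤ (S.filter fun τ => v τ ≤ t).card} =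
      ⋃ U ∈ S.powerset.filter (fun U => r ≤ U.card), ⋂ τ ∈ U, {t : ℝ | v τ ≤ t} := by
    ext t
    simp only [Set.mem_ofPred_eq, Finset.mem_filter, Finset.mem_powerset, Set.mem_iUnion,
      Set.mem_iInter, exists_prop]
    constructor
    · intro ht
      exact ⟨S.filter fun τ => v τ ≤ t, ⟨Finset.filter_subset _ _, ht⟩,
        fun τ hτ => (Finset.mem_filter.1 hτ).2⟩
    · rintro ⟨U, ⟨hU, hr⟩, ht⟩
      exact hr.trans (Finset.card_le_card fun τ hτ => Finset.mem_filter.2 ⟨hU hτ, ht τ hτ⟩)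
  rw [h]
  exact isClosed_biUnion_finset fun U _ => isClosed_biInter fun τ _ => isClosed_le continuous_const continuous_id

variable {v S r}

theorem bddBelow_orderStat_set (h1 : 1 ≤ r) :
    BddBelow {t : ℝ | r ≤ (S.filter fun τ => v τ ≤ t).card} := by
  obtain ⟨M, hM⟩ := (Set.finite_range v).bddBelow
  refine ⟨M, fun t ht => ?_⟩
  obtain ⟨τ, hτ⟩ := Finset.card_pos.1 (lt_of_lt_of_le h1 ht)
  exact (hM ⟨τ, rfl⟩).trans (Finset.mem_filter.1 hτ).2

theorem nonempty_orderStat_set (h2 : r ≤ S.card) :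
    {t : ℝ | r ≤ (S.filter fun τ => v τ ≤ t).card}.Nonempty := by
  obtain ⟨M, hM⟩ := (Set.finite_range v).bddAbove
  refine ⟨M, ?_⟩
  rw [Set.mem_ofPred_eq, Finset.filter_true_of_mem fun τ _ => hM ⟨τ, rfl⟩]
  exact h2

/-- Closedness makes the infimum attained. The bounds on the rank exclude the junk values of `sInf`:
rank $0$ gives all of $\mathbb R$, too large a rank the empty set. -/
theorem orderStat_le_iff (h1 : 1 ≤ r) (h2 : r ≤ S.card) {t : ℝ} :
    orderStat v S r ≤ t ↔ r ≤ (S.filter fun τ => v τ ≤ t).card := by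
  constructor
  · intro h
    have h0 := (isClosed_orderStat_set v S r).csInf_mem (nonempty_orderStat_set h2)
      (bddBelow_orderStat_set h1)
    refine le_trans h0 (Finset.card_le_card fun τ hτ => ?_)
    rw [Finset.mem_filter] at hτ ⊢
    exact ⟨hτ.1, hτ.2.trans h⟩
  · intro h
    exact csInf_le (bddBelow_orderStat_set h1) h

theorem card_filter_le_orderStat (hv : Function.Injective v) (h1 : 1 ≤ r) (h2 : r ≤ S.card) :
    (S.filter fun τ => v τ ≤ orderStat v S r).card = r := by
  refine le_antisymm ?_ ((orderStat_le_iff h1 h2).1 le_rfl)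
  set t := orderStat v S r with ht
  -- If $r$ values were strictly below $t$, the largest of them would bound the order statistic by
  -- something smaller than $t$.
  have hlt : (S.filter fun τ => v τ < t).card < r := by
    by_contra! hc
    obtain ⟨σ, hσ, hmax⟩ := Finset.exists_max_image (S.filter fun τ => v τ < t) v
      (Finset.card_pos.1 (lt_of_lt_of_le h1 hc))
    have : t ≤ v σ := (orderStat_le_iff h1 h2).2 (hc.trans (Finset.card_le_card fun τ hτ =>
      Finset.mem_filter.2 ⟨(Finset.mem_filter.1 hτ).1, hmax τ hτ⟩))
    exact absurd (Finset.mem_filter.1 hσ).2 (not_lt.2 this)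
  have hsub : (S.filter fun τ => v τ ≤ t) ⊆
      (S.filter fun τ => v τ < t) ∪ (S.filter fun τ => v τ = t) := by
    intro τ hτ
    rw [Finset.mem_filter] at hτ
    rcases hτ.2.lt_or_eq with h | h <;> simp [hτ.1, h]
  have hone : (S.filter fun τ => v τ = t).card ≤ 1 :=
    Finset.card_le_one.2 fun τ hτ σ hσ =>
      hv ((Finset.mem_filter.1 hτ).2.trans (Finset.mem_filter.1 hσ).2.symm)
  have := (Finset.card_le_card hsub).trans (Finset.card_union_le _ _)
  omega

/-- All three branches of the cut give the same floor. The strict inequality $a<v_\tau$ is what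
makes rank $0$ correct. -/
theorem card_filter_le_cutPoint (hv : Function.Injective v) {a b : EReal}
    (hab : ∀ τ ∈ S, a < v τ ∧ (v τ : EReal) ≤ b) {q s : ℕ} (hs : s ≤ q + 1) :
    (S.filter fun τ => (v τ : EReal) ≤ cutPoint a b v S q s).card = S.card * s / (q + 1) := by
  unfold cutPoint
  split_ifs with h1 h2
  · rw [Finset.filter_true_of_mem fun τ hτ => (hab τ hτ).2, h1, Nat.mul_div_cancel _ (by omega)]
  · rw [h2, Finset.filter_false_of_mem fun τ hτ => not_le.2 (hab τ hτ).1, Finset.card_empty]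
  · simp only [EReal.coe_le_coe_iff]
    refine card_filter_le_orderStat hv (Nat.one_le_iff_ne_zero.2 h2) ?_
    calc S.card * s / (q + 1) ≤ S.card * (q + 1) / (q + 1) := by gcongr
      _ = S.card := Nat.mul_div_cancel _ (by omega)

end OrderStat

/-! ### The multi-indices -/

theorem mem_cells_succ {p : List ℕ → ℕ} {j : ℕ} {J : List ℕ} :
    J ∈ cells p (j + 1) ↔ ∃ K ∈ cells p j, ∃ s ≤ p K, J = s :: K := by
  simp [cells, eq_comm]

theorem length_of_mem_cells {p : List ℕ → ℕ} {j : ℕ} {J : List ℕ} (h : J ∈ cells p j) :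
    J.length = j := by
  induction j generalizing J with
  | zero => simp [cells] at h; simp [h]
  | succ j ih =>
    obtain ⟨K, hK, s, _, rfl⟩ := mem_cells_succ.1 h
    simp [ih hK]

theorem estMass_pos (p : List ℕ → ℕ) (J : List ℕ) : 0 < estMass p J := by
  induction J with
  | nil => simp [estMass]
  | cons s J ih => simp only [estMass]; positivity

theorem estMass_le_one (p : List ℕ → ℕ) (J : List ℕ) : estMass p J ≤ 1 := by
  induction J with
  | nil => simp [estMass]
  | cons s J ih =>
    simp only [estMass]
    exact div_le_one_of_le₀ (ih.trans (by simp)) (by positivity)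

theorem sum_estMass (p : List ℕ → ℕ) (j : ℕ) : ∑ J ∈ cells p j, estMass p J = 1 := by
  induction j with
  | zero => simp [cells, estMass]
  | succ j ih =>
    rw [cells, Finset.sum_biUnion]
    · rw [← ih]
      refine Finset.sum_congr rfl fun J _ => ?_
      rw [Finset.sum_image (by simp)]
      simp only [estMass, Finset.sum_const, Finset.card_range, nsmul_eq_mul]
      push_cast
      field_simp
    · intro J _ K _ hJK
      rw [Function.onFun, Finset.disjoint_left]
      intro L hL hL'
      simp only [Finset.mem_image] at hL hL'
      obtain ⟨s, _, rfl⟩ := hL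
      obtain ⟨t, _, h⟩ := hL'
      simp at h
      exact hJK h.2.symm

/-! ### Half spaces, boxes and counts -/

section Boxes

variable {k n : ℕ}

/-- The half space of the points whose `i`-th coordinate is at most `c`. -/
def halfSpace (i : Fin k) (c : EReal) : Set (Fin k → ℝ) := {y | (y i : EReal) ≤ c}

/-- The half-open box `∏ (lo i, hi i]`. -/
def hbox (lo hi : Fin k → EReal) : Set (Fin k → ℝ) :=
  {y | ∀ i, lo i < (y i : EReal) ∧ (y i : EReal) ≤ hi i}

/-- The half-open boxes. -/
def IsHBox (B : Set (Fin k → ℝ)) : Prop := ∃ lo hi, B = hbox lo hi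

theorem IsHBox.inter {A B : Set (Fin k → ℝ)} (hA : IsHBox A) (hB : IsHBox B) : IsHBox (A ∩ B) := by
  obtain ⟨lo, hi, rfl⟩ := hA
  obtain ⟨lo', hi', rfl⟩ := hB
  refine ⟨fun i => max (lo i) (lo' i), fun i => min (hi i) (hi' i), ?_⟩
  ext y
  simp only [hbox, Set.mem_inter_iff, Set.mem_ofPred_eq, max_lt_iff, le_min_iff, ← forall_and]
  exact forall_congr' fun i => by tauto

theorem isHBox_slab (i : Fin k) (c c' : EReal) : IsHBox (halfSpace i c' \ halfSpace i c) := by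
  refine ⟨fun j => if j = i then c else ⊥, fun j => if j = i then c' else ⊤, ?_⟩
  ext y
  simp only [hbox, halfSpace, Set.mem_sdiff, Set.mem_ofPred_eq, not_le]
  constructor
  · rintro ⟨h1, h2⟩ j
    by_cases h : j = i
    · subst h; simp [h1, h2]
    · simp [h]
  · intro h
    have := h i
    simp at this
    tauto

theorem isHBox_halfSpace (i : Fin k) (c : EReal) : IsHBox (halfSpace i c) := by
  have := isHBox_slab i ⊥ c
  rwa [show halfSpace i ⊥ = ∅ by ext y; simp [halfSpace], Set.sdiff_empty] at this

theorem measurableSet_halfSpace (i : Fin k) (c : EReal) : MeasurableSet (halfSpace i c) :=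
  measurableSet_le (measurable_coe_real_ereal.comp (measurable_pi_apply i)) measurable_const

theorem IsHBox.measurableSet {B : Set (Fin k → ℝ)} (hB : IsHBox B) : MeasurableSet B := by
  obtain ⟨lo, hi, rfl⟩ := hB
  have : hbox lo hi = ⋂ i, (halfSpace i (hi i) \ halfSpace i (lo i)) := by
    ext y
    simp [hbox, halfSpace, and_comm]
  rw [this]
  exact MeasurableSet.iInter fun i => (measurableSet_halfSpace i _).diff (measurableSet_halfSpace i _)

/-- The points of the box that are not on a lower face. -/
abbrev innerBox (a b : Fin k → EReal) : Set (Fin k → ℝ) := hbox a b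

theorem mem_members {x : Fin n → Fin k → ℝ} {A : Set (Fin k → ℝ)} {τ : Fin n} :
    τ ∈ members x A ↔ x τ ∈ A := by
  simp [members]

theorem members_congr {x : Fin n → Fin k → ℝ} {A B : Set (Fin k → ℝ)}
    (h : ∀ τ, x τ ∈ A ↔ x τ ∈ B) : members x A = members x B := by
  ext τ; simp [mem_members, h]

theorem region_cons (a b : Fin k → EReal) (p : List ℕ → ℕ) (x : Fin n → Fin k → ℝ) (s : ℕ)
    {J : List ℕ} (h : J.length < k) :
    region a b p x (s :: J) = region a b p x J ∩
      (halfSpace ⟨J.length, h⟩ (cutPoint (a ⟨J.length, h⟩) (b ⟨J.length, h⟩)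
          (fun τ => x τ ⟨J.length, h⟩) (members x (region a b p x J)) (p J) (s + 1)) \
        halfSpace ⟨J.length, h⟩ (cutPoint (a ⟨J.length, h⟩) (b ⟨J.length, h⟩)
          (fun τ => x τ ⟨J.length, h⟩) (members x (region a b p x J)) (p J) s)) := by
  ext y
  simp [region, halfSpace, h, and_comm]

/-- The root region is closed below while every cut is half-open. Removing the lower faces yields a
half-open box, and affects neither counts of a generic sample nor masses. -/
theorem isHBox_region_inter_innerBox (a b : Fin k → EReal) (p : List ℕ → ℕ) (x : Fin n → Fin k → ℝ)
    {J : List ℕ} (h : J.length ≤ k) : IsHBox (region a b p x J ∩ innerBox a b) := by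
  induction J with
  | nil =>
    refine ⟨a, b, Set.inter_eq_right.2 fun y hy i => ⟨(hy i).1.le, (hy i).2⟩⟩
  | cons s J ih =>
    have hJ : J.length < k := by simpa using h
    rw [region_cons a b p x s hJ, Set.inter_right_comm]
    exact (ih hJ.le).inter (isHBox_slab _ _ _)

/-- A sample in general position: all points are in the box, off the lower faces, and no two of
them share a coordinate. -/
structure Generic (a b : Fin k → EReal) (x : Fin n → Fin k → ℝ) : Prop where
  mem : ∀ τ, x τ ∈ innerBox a b
  inj : ∀ i, Function.Injective fun τ => x τ i

variable {a b : Fin k → EReal} {x : Fin n → Fin k → ℝ}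

theorem card_members_inter_halfSpace (hx : Generic a b x) (p : List ℕ → ℕ) {J : List ℕ}
    (h : J.length < k) {s : ℕ} (hs : s ≤ p J + 1) :
    (members x (region a b p x J ∩ halfSpace ⟨J.length, h⟩
      (cutPoint (a ⟨J.length, h⟩) (b ⟨J.length, h⟩)
          (fun τ => x τ ⟨J.length, h⟩) (members x (region a b p x J)) (p J) s))).card =
      (members x (region a b p x J)).card * s / (p J + 1) := by
  rw [← card_filter_le_cutPoint (hx.inj ⟨J.length, h⟩)
    (fun τ _ => hx.mem τ ⟨J.length, h⟩) hs]
  congr 1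
  ext τ
  simp [mem_members, halfSpace]

theorem halfSpace_mono {i : Fin k} {c c' : EReal} (h : c ≤ c') : halfSpace i c ⊆ halfSpace i c' :=
  fun _ hy => le_trans (α := EReal) hy h

theorem card_members_cons (hx : Generic a b x) (p : List ℕ → ℕ) {J : List ℕ}
    (h : J.length < k) {s : ℕ} (hs : s ≤ p J) :
    (members x (region a b p x (s :: J))).card =
      (members x (region a b p x J)).card * (s + 1) / (p J + 1) -
      (members x (region a b p x J)).card * s / (p J + 1) := by
  rw [← card_members_inter_halfSpace hx p h (s := s + 1) (by omega),
    ← card_members_inter_halfSpace hx p h (s := s) (by omega), region_cons a b p x s h]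
  have h1 := card_members_inter_halfSpace hx p h (s := s + 1) (by omega)
  have h2 := card_members_inter_halfSpace hx p h (s := s) (by omega)
  revert h1 h2
  generalize cutPoint (a ⟨J.length, h⟩) (b ⟨J.length, h⟩) (fun τ => x τ ⟨J.length, h⟩)
    (members x (region a b p x J)) (p J) (s + 1) = c'
  generalize cutPoint (a ⟨J.length, h⟩) (b ⟨J.length, h⟩) (fun τ => x τ ⟨J.length, h⟩)
    (members x (region a b p x J)) (p J) s = c
  intro h1 h2
  set A := region a b p x J
  set i : Fin k := ⟨J.length, h⟩
  rcases le_total c c' with hc | hc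
  · rw [← Finset.card_sdiff_of_subset]
    · congr 1
      ext τ
      simp only [Finset.mem_sdiff, mem_members, Set.mem_inter_iff, Set.mem_sdiff]
      tauto
    · intro τ
      simp only [mem_members, Set.mem_inter_iff]
      exact fun hτ => ⟨hτ.1, halfSpace_mono hc hτ.2⟩
  -- Monotonicity of the cut points need not be known: for reversed cuts the slab is empty and the
  -- truncated subtraction is also $0$.
  · have h3 : members x (A ∩ (halfSpace i c' \ halfSpace i c)) = ∅ := by
      rw [Set.sdiff_eq_empty.2 (halfSpace_mono hc)]
      ext τ
      simp [mem_members]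
    rw [h3, Finset.card_empty]
    have h4 : (members x (A ∩ halfSpace i c')).card ≤ (members x (A ∩ halfSpace i c)).card := by
      refine Finset.card_le_card fun τ => ?_
      simp only [mem_members, Set.mem_inter_iff]
      exact fun hτ => ⟨hτ.1, halfSpace_mono hc hτ.2⟩
    omega

theorem abs_floor_sub_le (N s q : ℕ) :
    ((N * s / (q + 1) : ℕ) : ℝ) ≤ (N : ℝ) * (s / (q + 1)) ∧
      (N : ℝ) * (s / (q + 1)) - 1 ≤ ((N * s / (q + 1) : ℕ) : ℝ) := by
  have hq : (0 : ℝ) < (q : ℝ) + 1 := by positivity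
  have h1 : (N : ℝ) * (s / (q + 1)) = ((N * s : ℕ) : ℝ) / ((q + 1 : ℕ) : ℝ) := by
    push_cast; ring
  rw [h1]
  refine ⟨Nat.cast_div_le, ?_⟩
  have := Nat.lt_floor_add_one (((N * s : ℕ) : ℝ) / ((q + 1 : ℕ) : ℝ))
  rw [Nat.floor_div_eq_div] at this
  linarith

/-- A split divides the inherited error by $p_K+1\ge 1$, and the difference of two floors adds at
most $1$. -/
theorem abs_card_members_sub_le (hx : Generic a b x) (p : List ℕ → ℕ) {j : ℕ} (hj : j ≤ k)
    {J : List ℕ} (hJ : J ∈ cells p j) :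
    |((members x (region a b p x J)).card : ℝ) - n * estMass p J| ≤ j := by
  induction j generalizing J with
  | zero =>
    simp only [cells, Finset.mem_singleton] at hJ
    subst hJ
    have : members x (region a b p x []) = Finset.univ := by
      ext τ
      simp only [mem_members, Finset.mem_univ, iff_true]
      exact fun i => ⟨(hx.mem τ i).1.le, (hx.mem τ i).2⟩
    simp [this, estMass]
  | succ j ih =>
    obtain ⟨K, hK, s, hs, rfl⟩ := mem_cells_succ.1 hJ
    have hlen := length_of_mem_cells hK
    have hKk : K.length < k := by omega
    have h := ih (by omega) hK
    rw [card_members_cons hx p hKk hs]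
    set N := (members x (region a b p x K)).card
    rw [Nat.cast_sub (by gcongr; omega)]
    obtain ⟨h1, h2⟩ := abs_floor_sub_le N (s + 1) (p K)
    obtain ⟨h3, h4⟩ := abs_floor_sub_le N s (p K)
    have hq : (1 : ℝ) ≤ (p K : ℝ) + 1 := by simp
    have h5 : (N : ℝ) * (((s + 1 : ℕ) : ℝ) / (p K + 1)) - N * (s / (p K + 1)) = N / (p K + 1) := by
      push_cast; field_simp; ring
    have h6 : |(N : ℝ) / (p K + 1) - n * estMass p (s :: K)| ≤ j := by
      have : (N : ℝ) / (p K + 1) - n * estMass p (s :: K) = (N - n * estMass p K) / (p K + 1) := by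
        simp only [estMass]; ring
      rw [this, abs_div, abs_of_pos (by positivity : (0 : ℝ) < (p K : ℝ) + 1)]
      exact (div_le_self (abs_nonneg _) hq).trans h
    rw [abs_le] at h6 ⊢
    push_cast at *
    constructor <;> linarith

end Boxes

/-! ### Population quantile cells and generic samples -/

section Population

variable {k : ℕ}

theorem measure_coord_eq_zero {μ : Measure (Fin k → ℝ)}
    (hcont : ∀ (i : Fin k) (t : ℝ), μ {y | y i = t} = 0) (i : Fin k) (c : EReal) :
    μ {y | (y i : EReal) = c} = 0 := by
  induction c with
  | bot => simp
  | top => simp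
  | coe t => simpa using hcont i t

theorem ae_coord_ne {μ : Measure (Fin k → ℝ)}
    (hcont : ∀ (i : Fin k) (t : ℝ), μ {y | y i = t} = 0) (i : Fin k) (c : EReal) :
    ∀ᵐ y ∂μ, (y i : EReal) ≠ c := by
  rw [ae_iff]
  simpa using measure_coord_eq_zero hcont i c

theorem ae_mem_innerBox {μ : Measure (Fin k → ℝ)} {a b : Fin k → EReal} (hsupp : ∀ᵐ y ∂μ, y ∈ box a b)
    (hcont : ∀ (i : Fin k) (t : ℝ), μ {y | y i = t} = 0) : ∀ᵐ y ∂μ, y ∈ innerBox a b := by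
  have h : ∀ᵐ y ∂μ, ∀ i, (y i : EReal) ≠ a i := ae_all_iff.2 fun i => ae_coord_ne hcont i (a i)
  filter_upwards [hsupp, h] with y hy hy' i
  exact ⟨lt_of_le_of_ne (hy i).1 (hy' i).symm, (hy i).2⟩

/-- Dominated convergence: for fixed $y$ the indicator is locally constant in $c$ away from $c=y_i$,
and the hyperplane $y_i=c$ is null. -/
theorem continuous_real_halfSpace (ν : Measure (Fin k → ℝ)) [IsFiniteMeasure ν]
    (hcont : ∀ (i : Fin k) (t : ℝ), ν {y | y i = t} = 0) (i : Fin k) :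
    Continuous fun c : EReal => ν.real (halfSpace i c) := by
  have h : (fun c : EReal => ν.real (halfSpace i c)) =
      fun c => ∫ y, (halfSpace i c).indicator (fun _ => (1 : ℝ)) y ∂ν := by
    ext c
    rw [integral_indicator_const _ (measurableSet_halfSpace i c)]
    simp
  rw [h, continuous_iff_continuousAt]
  intro c
  refine continuousAt_of_dominated (bound := fun _ => 1) ?_ ?_ (integrable_const _) ?_
  · exact Eventually.of_forall fun c =>
      (measurable_const.indicator (measurableSet_halfSpace i c)).aestronglyMeasurable
  · refine Eventually.of_forall fun c => Eventually.of_forall fun y => ?_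
    by_cases hy : y ∈ halfSpace i c <;> simp [hy]
  · filter_upwards [ae_coord_ne hcont i c] with y hy
    rcases lt_or_gt_of_ne hy with h | h
    · refine (continuousAt_const (y := (1 : ℝ))).congr ?_
      filter_upwards [lt_mem_nhds h] with c' hc'
      rw [Set.indicator_of_mem]
      exact hc'.le
    · refine (continuousAt_const (y := (0 : ℝ))).congr ?_
      filter_upwards [gt_mem_nhds h] with c' hc'
      rw [Set.indicator_of_notMem]
      exact not_le.2 hc'

/-- Intermediate value theorem on `EReal`, where the level $\bot$ gives mass $0$ and $\top$ the full
mass. -/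
theorem exists_real_inter_halfSpace_eq {μ : Measure (Fin k → ℝ)} [IsFiniteMeasure μ]
    (hcont : ∀ (i : Fin k) (t : ℝ), μ {y | y i = t} = 0) (i : Fin k) (A : Set (Fin k → ℝ))
    {θ : ℝ} (h0 : 0 ≤ θ) (h1 : θ ≤ μ.real A) :
    ∃ c : EReal, μ.real (A ∩ halfSpace i c) = θ := by
  have hc : ∀ (i : Fin k) (t : ℝ), μ.restrict A {y | y i = t} = 0 := fun i t =>
    le_antisymm ((Measure.restrict_apply_le A _).trans (hcont i t).le) bot_le
  have h : ∀ c, (μ.restrict A).real (halfSpace i c) = μ.real (A ∩ halfSpace i c) := fun c => by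
    rw [measureReal_restrict_apply (measurableSet_halfSpace i c), Set.inter_comm]
  have hcon := continuous_real_halfSpace (μ.restrict A) hc i
  simp only [h] at hcon
  refine mem_range_of_exists_le_of_exists_ge hcon ⟨⊥, ?_⟩ ⟨⊤, ?_⟩
  · simpa [halfSpace] using h0
  · simpa [halfSpace] using h1

/-- A point `c` below whose level in the coordinate `i` the set `A` has the proportion `θ` of its
mass. -/
noncomputable def quantileCut (μ : Measure (Fin k → ℝ)) (A : Set (Fin k → ℝ)) (i : Fin k) (θ : ℝ) :
    EReal :=
  open Classical in
  if h : ∃ c : EReal, μ.real (A ∩ halfSpace i c) = θ * μ.real A then h.choose else ⊥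

/-- The regions made from the quantiles of `μ` itself in place of those of a sample. -/
def popCell (μ : Measure (Fin k → ℝ)) (p : List ℕ → ℕ) : List ℕ → Set (Fin k → ℝ)
  | [] => Set.univ
  | s :: J => popCell μ p J ∩ {y | ∃ h : J.length < k,
      y ∈ halfSpace ⟨J.length, h⟩
          (quantileCut μ (popCell μ p J) ⟨J.length, h⟩ (((s + 1 : ℕ) : ℝ) / ((p J : ℝ) + 1))) \
        halfSpace ⟨J.length, h⟩
          (quantileCut μ (popCell μ p J) ⟨J.length, h⟩ ((s : ℝ) / ((p J : ℝ) + 1)))}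

theorem popCell_cons (μ : Measure (Fin k → ℝ)) (p : List ℕ → ℕ) (s : ℕ) {J : List ℕ}
    (h : J.length < k) :
    popCell μ p (s :: J) = popCell μ p J ∩ (halfSpace ⟨J.length, h⟩
          (quantileCut μ (popCell μ p J) ⟨J.length, h⟩ (((s + 1 : ℕ) : ℝ) / ((p J : ℝ) + 1))) \
        halfSpace ⟨J.length, h⟩
          (quantileCut μ (popCell μ p J) ⟨J.length, h⟩ ((s : ℝ) / ((p J : ℝ) + 1)))) := by
  ext y
  simp [popCell, h]

theorem measurableSet_popCell (μ : Measure (Fin k → ℝ)) (p : List ℕ → ℕ) {J : List ℕ}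
    (h : J.length ≤ k) : MeasurableSet (popCell μ p J) := by
  induction J with
  | nil => exact MeasurableSet.univ
  | cons s J ih =>
    have hJ : J.length < k := by simpa using h
    rw [popCell_cons μ p s hJ]
    exact (ih hJ.le).inter ((measurableSet_halfSpace _ _).diff (measurableSet_halfSpace _ _))

variable {μ : Measure (Fin k → ℝ)} [IsProbabilityMeasure μ]

theorem real_inter_quantileCut (hcont : ∀ (i : Fin k) (t : ℝ), μ {y | y i = t} = 0)
    (A : Set (Fin k → ℝ)) (i : Fin k) {θ : ℝ} (h0 : 0 ≤ θ) (h1 : θ ≤ 1) :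
    μ.real (A ∩ halfSpace i (quantileCut μ A i θ)) = θ * μ.real A := by
  have h := exists_real_inter_halfSpace_eq hcont i A (mul_nonneg h0 measureReal_nonneg)
    (mul_le_of_le_one_left measureReal_nonneg h1)
  rw [quantileCut, dif_pos h]
  exact h.choose_spec

theorem real_popCell (hcont : ∀ (i : Fin k) (t : ℝ), μ {y | y i = t} = 0) (p : List ℕ → ℕ)
    {j : ℕ} (hj : j ≤ k) {J : List ℕ} (hJ : J ∈ cells p j) :
    μ.real (popCell μ p J) = estMass p J := by
  induction j generalizing J with
  | zero =>
    simp only [cells, Finset.mem_singleton] at hJ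
    subst hJ
    simp [popCell, estMass]
  | succ j ih =>
    obtain ⟨K, hK, s, hs, rfl⟩ := mem_cells_succ.1 hJ
    have hlen := length_of_mem_cells hK
    have hKk : K.length < k := by omega
    have h := ih (by omega) hK
    rw [popCell_cons μ p s hKk]
    have hq : (0 : ℝ) < (p K : ℝ) + 1 := by positivity
    have hs' : (s : ℝ) ≤ p K := by exact_mod_cast hs
    have e1 := real_inter_quantileCut hcont (popCell μ p K) ⟨K.length, hKk⟩
      (θ := ((s + 1 : ℕ) : ℝ) / ((p K : ℝ) + 1)) (by positivity)
      (by rw [div_le_one hq]; push_cast; linarith)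
    have e2 := real_inter_quantileCut hcont (popCell μ p K) ⟨K.length, hKk⟩
      (θ := (s : ℝ) / ((p K : ℝ) + 1)) (by positivity) (by rw [div_le_one hq]; linarith)
    generalize quantileCut μ (popCell μ p K) ⟨K.length, hKk⟩ (((s + 1 : ℕ) : ℝ) / ((p K : ℝ) + 1))
      = c' at *
    generalize quantileCut μ (popCell μ p K) ⟨K.length, hKk⟩ ((s : ℝ) / ((p K : ℝ) + 1)) = c at *
    rw [h] at e1 e2
    set A := popCell μ p K
    have hA : MeasurableSet A := measurableSet_popCell μ p hKk.le
    have hm := estMass_pos p K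
    -- Quantiles need not be unique and are chosen arbitrarily, so the order of the two cuts is
    -- recovered from the strict inequality of masses.
    have hlt : μ.real (A ∩ halfSpace ⟨K.length, hKk⟩ c) <
        μ.real (A ∩ halfSpace ⟨K.length, hKk⟩ c') := by
      rw [e1, e2]
      gcongr
      simp
    have hcc : c ≤ c' := by
      by_contra! hcon
      exact absurd (measureReal_mono (μ := μ)
        (Set.inter_subset_inter_right A (halfSpace_mono (i := ⟨K.length, hKk⟩) hcon.le)))
        (not_le.2 hlt)
    have : A ∩ (halfSpace ⟨K.length, hKk⟩ c' \ halfSpace ⟨K.length, hKk⟩ c) =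
        (A ∩ halfSpace ⟨K.length, hKk⟩ c') \ (A ∩ halfSpace ⟨K.length, hKk⟩ c) := by
      ext y; simp only [Set.mem_inter_iff, Set.mem_sdiff]; tauto
    rw [this, measureReal_sdiff (Set.inter_subset_inter_right A (halfSpace_mono hcc))
      (hA.inter (measurableSet_halfSpace _ _)), e1, e2]
    simp only [estMass]
    push_cast
    field_simp
    ring

instance (n : ℕ) : IsProbabilityMeasure (sampleLaw μ n) := by
  unfold sampleLaw; infer_instance

theorem ae_generic {a b : Fin k → EReal} (hsupp : ∀ᵐ y ∂μ, y ∈ box a b)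
    (hcont : ∀ (i : Fin k) (t : ℝ), μ {y | y i = t} = 0) (n : ℕ) :
    ∀ᵐ x ∂(sampleLaw μ n), Generic a b x := by
  have h1 : ∀ᵐ x ∂(sampleLaw μ n), ∀ τ, x τ ∈ innerBox a b := ae_all_iff.2 fun τ =>
    (Measure.tendsto_eval_ae_ae (μ := fun _ : Fin n => μ) (i := τ)).eventually
      (ae_mem_innerBox hsupp hcont)
  have h2 : ∀ᵐ x ∂(sampleLaw μ n), ∀ i τ σ, τ ≠ σ → x τ i ≠ x σ i := by
    refine ae_all_iff.2 fun i => ae_all_iff.2 fun τ => ae_all_iff.2 fun σ => ?_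
    by_cases hne : τ = σ
    · simp [hne]
    have hind : ProbabilityTheory.IndepFun (fun x : Fin n → Fin k → ℝ => x τ) (fun x => x σ)
        (sampleLaw μ n) :=
      (ProbabilityTheory.iIndepFun_pi (μ := fun _ : Fin n => μ) (X := fun _ => id)
        fun _ => aemeasurable_id).indepFun hne
    have hmap := (ProbabilityTheory.indepFun_iff_map_prod_eq_prod_map_map
      (measurable_pi_apply τ).aemeasurable (measurable_pi_apply σ).aemeasurable).1 hind
    have e : ∀ ρ : Fin n, (sampleLaw μ n).map (fun x => x ρ) = μ := fun ρ =>
      (measurePreserving_eval (fun _ : Fin n => μ) ρ).map_eq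
    rw [e, e] at hmap
    have hms : MeasurableSet {q : (Fin k → ℝ) × (Fin k → ℝ) | q.1 i = q.2 i} :=
      measurableSet_eq_fun (by fun_prop) (by fun_prop)
    -- Fubini: each section of the diagonal is a hyperplane, which is null.
    have h0 : (μ.prod μ) {q : (Fin k → ℝ) × (Fin k → ℝ) | q.1 i = q.2 i} = 0 := by
      rw [Measure.measure_prod_null hms]
      refine Eventually.of_forall fun y => ?_
      simpa [Set.preimage, eq_comm] using hcont i (y i)
    rw [← hmap, Measure.map_apply (by fun_prop) hms] at h0
    have : ∀ᵐ x ∂(sampleLaw μ n), x τ i ≠ x σ i := by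
      rw [ae_iff]
      simpa [Set.preimage] using h0
    filter_upwards [this] with x hx _ using hx
  filter_upwards [h1, h2] with x hx hx'
  exact ⟨hx, fun i τ σ h => by_contra fun hne => hx' i τ σ hne h⟩

end Population

/-! ### Measurability of the true masses -/

section Measurability

variable {k n : ℕ}

theorem measurable_cutPoint (a b : EReal) (i : Fin k) (S : Finset (Fin n)) {q s : ℕ}
    (hs : s ≤ q + 1) :
    Measurable fun x : Fin n → Fin k → ℝ => cutPoint a b (fun τ => x τ i) S q s := by
  unfold cutPoint
  split_ifs with h1 h2
  · exact measurable_const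
  · exact measurable_const
  · refine measurable_coe_real_ereal.comp (measurable_of_Iic fun t => ?_)
    have hr : S.card * s / (q + 1) ≤ S.card := by
      calc S.card * s / (q + 1) ≤ S.card * (q + 1) / (q + 1) := by gcongr
        _ = S.card := Nat.mul_div_cancel _ (by omega)
    have : (fun x : Fin n → Fin k → ℝ => orderStat (fun τ => x τ i) S (S.card * s / (q + 1))) ⁻¹'
        Set.Iic t = ⋃ U ∈ S.powerset.filter (fun U => S.card * s / (q + 1) ≤ U.card),
          ⋂ τ ∈ U, {x : Fin n → Fin k → ℝ | x τ i ≤ t} := by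
      ext x
      simp only [Set.mem_preimage, Set.mem_Iic, orderStat_le_iff (Nat.one_le_iff_ne_zero.2 h2) hr,
        Finset.mem_filter, Finset.mem_powerset, Set.mem_iUnion, Set.mem_iInter, exists_prop,
        Set.mem_ofPred_eq]
      constructor
      · intro ht
        exact ⟨S.filter fun τ => x τ i ≤ t, ⟨Finset.filter_subset _ _, ht⟩,
          fun τ hτ => (Finset.mem_filter.1 hτ).2⟩
      · rintro ⟨U, ⟨hU, hr⟩, ht⟩
        exact hr.trans (Finset.card_le_card fun τ hτ => Finset.mem_filter.2 ⟨hU hτ, ht τ hτ⟩)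
    rw [this]
    refine Finset.measurableSet_biUnion _ fun U _ => Finset.measurableSet_biInter _ fun τ _ => ?_
    exact measurableSet_le (by fun_prop) measurable_const

theorem measurableSet_members_eq {R : (Fin n → Fin k → ℝ) → Set (Fin k → ℝ)}
    (hR : MeasurableSet {q : (Fin n → Fin k → ℝ) × (Fin k → ℝ) | q.2 ∈ R q.1})
    (S : Finset (Fin n)) : MeasurableSet {x | members x (R x) = S} := by
  have : {x : Fin n → Fin k → ℝ | members x (R x) = S} =
      ⋂ τ, {x | x τ ∈ R x ↔ τ ∈ S} := by
    ext x
    simp [Finset.ext_iff, mem_members]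
  rw [this]
  refine MeasurableSet.iInter fun τ => ?_
  have h : MeasurableSet {x : Fin n → Fin k → ℝ | x τ ∈ R x} :=
    (measurable_id.prodMk (measurable_pi_apply τ)) hR
  by_cases hτ : τ ∈ S
  · simpa [hτ] using h
  · simp only [hτ, iff_false]
    exact h.compl

theorem measurableSet_region (a b : Fin k → EReal) (p : List ℕ → ℕ) {j : ℕ} (hj : j ≤ k)
    {J : List ℕ} (hJ : J ∈ cells p j) :
    MeasurableSet {q : (Fin n → Fin k → ℝ) × (Fin k → ℝ) | q.2 ∈ region a b p q.1 J} := by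
  induction j generalizing J with
  | zero =>
    simp only [cells, Finset.mem_singleton] at hJ
    subst hJ
    have : {q : (Fin n → Fin k → ℝ) × (Fin k → ℝ) | q.2 ∈ region a b p q.1 []} =
        ⋂ i, ({q | a i ≤ (q.2 i : EReal)} ∩ {q | (q.2 i : EReal) ≤ b i}) := by
      ext q
      simp [region, box]
    rw [this]
    refine MeasurableSet.iInter fun i => MeasurableSet.inter ?_ ?_
    · exact measurableSet_le measurable_const (by fun_prop)
    · exact measurableSet_le (by fun_prop) measurable_const
  | succ j ih =>
    obtain ⟨K, hK, s, hs, rfl⟩ := mem_cells_succ.1 hJ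
    have hlen := length_of_mem_cells hK
    have hKk : K.length < k := by omega
    have h := ih (by omega) hK
    set i : Fin k := ⟨K.length, hKk⟩ with hi
    -- The cut depends on the sample also through the set of points in the parent region. Splitting
    -- over the finitely many values $S$ of that set leaves cuts measurable for fixed $S$.
    have : {q : (Fin n → Fin k → ℝ) × (Fin k → ℝ) | q.2 ∈ region a b p q.1 (s :: K)} =
        ⋃ S : Finset (Fin n), ({q | q.2 ∈ region a b p q.1 K} ∩
          (Prod.fst ⁻¹' {x | members x (region a b p x K) = S} ∩
          ({q : (Fin n → Fin k → ℝ) × (Fin k → ℝ) | (q.2 i : EReal) ≤ cutPoint (a i) (b i) (fun τ => q.1 τ i) S (p K) (s + 1)} ∩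
            {q : (Fin n → Fin k → ℝ) × (Fin k → ℝ) |
              cutPoint (a i) (b i) (fun τ => q.1 τ i) S (p K) s < (q.2 i : EReal)}))) := by
      ext q
      simp only [Set.mem_ofPred_eq, region_cons a b p q.1 s hKk, Set.mem_inter_iff, Set.mem_sdiff,
        halfSpace, not_le, Set.mem_iUnion, Set.mem_preimage, exists_and_left, exists_eq_left',
        ← hi]
    rw [this]
    refine MeasurableSet.iUnion fun S => h.inter
      ((measurable_fst (measurableSet_members_eq h S)).inter (MeasurableSet.inter ?_ ?_))
    · exact measurableSet_le (by fun_prop)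
        ((measurable_cutPoint (a i) (b i) i S (by omega)).comp measurable_fst)
    · exact measurableSet_lt
        ((measurable_cutPoint (a i) (b i) i S (by omega)).comp measurable_fst) (by fun_prop)

theorem measurable_trueMass (a b : Fin k → EReal) (p : List ℕ → ℕ) (μ : Measure (Fin k → ℝ))
    [IsProbabilityMeasure μ] {j : ℕ} (hj : j ≤ k) {J : List ℕ} (hJ : J ∈ cells p j) :
    Measurable fun x : Fin n → Fin k → ℝ => trueMass a b p μ x J :=
  (measurable_measure_prodMk_left (ν := μ) (measurableSet_region a b p hj hJ)).ennreal_toReal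

end Measurability

/-! ### Concentration -/

/-- Exponential Markov inequality, with $e^t\le 1+t+t^2$ for $|t|\le 1$ applied to $t=s(g-Eg)$. This
is why $s\le 1/2$: $|g-Eg|\le 2$. The parameter $s$ is left free for later tuning. -/
theorem bernstein {E : Type*} [MeasurableSpace E] (μ : Measure E) [IsProbabilityMeasure μ]
    {g : E → ℝ} (hg : Measurable g) (hb : ∀ y, |g y| ≤ 1) {v s : ℝ} (u : ℝ)
    (hv : ∫ y, g y ^ 2 ∂μ ≤ v) (hs0 : 0 ≤ s) (hs1 : s ≤ 1 / 2) (n : ℕ) :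
    (Measure.pi fun _ : Fin n => μ).real {x | u ≤ ∑ τ, (g (x τ) - ∫ y, g y ∂μ)} ≤
      Real.exp (-(s * u) + s ^ 2 * n * v) := by
  have hgi : Integrable g μ := Integrable.of_bound hg.aestronglyMeasurable 1
    (Eventually.of_forall hb)
  have hg2 : Integrable (fun y => g y ^ 2) μ := Integrable.of_bound
    (hg.pow_const 2).aestronglyMeasurable 1 (Eventually.of_forall fun y => by
      rw [Real.norm_eq_abs, abs_pow]; exact pow_le_one₀ (abs_nonneg _) (hb y))
  set e := ∫ y, g y ∂μ with he
  have he1 : |e| ≤ 1 := by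
    have := norm_integral_le_of_norm_le_const (μ := μ) (f := g) (C := 1) (Eventually.of_forall hb)
    simpa using this
  have hd : ∀ y, |s * (g y - e)| ≤ 1 := fun y => by
    rw [abs_mul, abs_of_nonneg hs0]
    have : |g y - e| ≤ 2 := (abs_sub _ _).trans (by linarith [hb y])
    nlinarith [abs_nonneg (g y - e)]
  set h : E → ℝ := fun y => Real.exp (s * (g y - e)) with hh
  have hhm : Measurable h := by fun_prop
  have hhb : ∀ y, |h y| ≤ Real.exp 1 := fun y => by
    rw [abs_of_pos (Real.exp_pos _)]
    exact Real.exp_le_exp.2 ((le_abs_self _).trans (hd y))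
  have hhi : Integrable h μ := Integrable.of_bound hhm.aestronglyMeasurable _
    (Eventually.of_forall hhb)
  have hint : ∫ y, h y ∂μ ≤ Real.exp (s ^ 2 * v) := by
    have h1 : ∫ y, h y ∂μ ≤ ∫ y, (1 + s * (g y - e) + s ^ 2 * (g y ^ 2 - 2 * e * g y + e ^ 2)) ∂μ := by
      refine integral_mono hhi (by fun_prop) fun y => ?_
      have := (abs_le.1 (Real.abs_exp_sub_one_sub_id_le (hd y))).2
      simp only [hh]
      nlinarith
    have h2 : ∫ y, (1 + s * (g y - e) + s ^ 2 * (g y ^ 2 - 2 * e * g y + e ^ 2)) ∂μ =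
        1 + s ^ 2 * (∫ y, g y ^ 2 ∂μ - e ^ 2) := by
      rw [integral_add (by fun_prop) (by fun_prop), integral_add (by fun_prop) (by fun_prop),
        integral_const_mul, integral_const_mul, integral_sub (by fun_prop) (by fun_prop),
        integral_add (by fun_prop) (by fun_prop), integral_sub (by fun_prop) (by fun_prop),
        integral_const_mul, ← he]
      simp only [integral_const, probReal_univ, smul_eq_mul, mul_one, one_mul, sub_self, mul_zero,
        add_zero]
      ring
    rw [h2] at h1
    refine h1.trans ?_
    have := Real.add_one_le_exp (s ^ 2 * v)
    nlinarith [sq_nonneg e, sq_nonneg s, mul_le_mul_of_nonneg_left hv (sq_nonneg s),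
      mul_nonneg (sq_nonneg s) (sq_nonneg e)]
  have hpow : ∫ x : Fin n → E, ∏ τ, h (x τ) ∂(Measure.pi fun _ => μ) ≤
      Real.exp (s ^ 2 * n * v) := by
    rw [integral_fintype_prod_eq_pow]
    calc (∫ y, h y ∂μ) ^ Fintype.card (Fin n) ≤ Real.exp (s ^ 2 * v) ^ Fintype.card (Fin n) :=
          pow_le_pow_left₀ (integral_nonneg fun y => (Real.exp_pos _).le) hint _
      _ = Real.exp (s ^ 2 * n * v) := by
          rw [← Real.exp_nat_mul, Fintype.card_fin]; ring_nf
  have hpi : Integrable (fun x : Fin n → E => ∏ τ, h (x τ)) (Measure.pi fun _ => μ) :=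
    Integrable.fintype_prod fun _ => hhi
  have hmk := mul_meas_ge_le_integral_of_nonneg (μ := Measure.pi fun _ : Fin n => μ)
    (f := fun x => ∏ τ, h (x τ))
    (Eventually.of_forall fun x => Finset.prod_nonneg fun τ _ => (Real.exp_pos _).le) hpi
    (Real.exp (s * u))
  have hsub : {x : Fin n → E | u ≤ ∑ τ, (g (x τ) - e)} ⊆
      {x | Real.exp (s * u) ≤ ∏ τ, h (x τ)} := by
    intro x hx
    simp only [Set.mem_ofPred_eq, hh] at hx ⊢
    rw [← Real.exp_sum, ← Finset.mul_sum]
    exact Real.exp_le_exp.2 (mul_le_mul_of_nonneg_left hx hs0)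
  rw [Real.exp_add, Real.exp_neg, inv_mul_eq_div, le_div_iff₀' (Real.exp_pos _)]
  exact (mul_le_mul_of_nonneg_left (measureReal_mono hsub) (Real.exp_pos _).le).trans
    (hmk.trans hpow)

/-! ### Empirical counts of fixed sets -/

section Counts

variable {k n : ℕ}

/-- The number of sample points in `A`, as a real number. -/
noncomputable def cnt (x : Fin n → Fin k → ℝ) (A : Set (Fin k → ℝ)) : ℝ := ((members x A).card : ℝ)

theorem cnt_eq_sum (x : Fin n → Fin k → ℝ) (A : Set (Fin k → ℝ)) :
    cnt x A = ∑ τ, A.indicator (fun _ => (1 : ℝ)) (x τ) := by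
  classical
  simp [cnt, members, Set.indicator_apply]

theorem cnt_mono (x : Fin n → Fin k → ℝ) {A B : Set (Fin k → ℝ)} (h : A ⊆ B) :
    cnt x A ≤ cnt x B := by
  refine Nat.cast_le.2 (Finset.card_le_card fun τ => ?_)
  simp only [mem_members]
  exact fun hτ => h hτ

theorem measurable_cnt {A : Set (Fin k → ℝ)} (hA : MeasurableSet A) :
    Measurable fun x : Fin n → Fin k → ℝ => cnt x A := by
  simp only [cnt_eq_sum]
  exact Finset.measurable_sum _ fun τ _ =>
    (measurable_const.indicator hA).comp (measurable_pi_apply τ)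

variable {μ : Measure (Fin k → ℝ)} [IsProbabilityMeasure μ]

/-- Markov's inequality for $\theta^{-\#}$, where $\#$ is the number of sample points in $G$: each
factor equals $\theta^{-1}$ on $G$ and $1$ elsewhere, so its mean is at most $2$. A bound with a
power of $\theta$ is needed, since it is later used as the mass tends to $0$. -/
theorem chernoff_cnt {G : Set (Fin k → ℝ)} (hG : MeasurableSet G) {θ : ℝ} (hθ : 0 < θ)
    (hμ : μ.real G ≤ θ) (r : ℕ) :
    (sampleLaw μ n).real {x | (r : ℝ) ≤ cnt x G} ≤ 2 ^ n * θ ^ r := by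
  rcases le_or_gt 1 θ with h1 | h1
  · exact measureReal_le_one.trans
      (one_le_mul_of_one_le_of_one_le (one_le_pow₀ (by norm_num)) (one_le_pow₀ h1))
  set h : (Fin k → ℝ) → ℝ := fun y => 1 + (θ⁻¹ - 1) * G.indicator (fun _ => 1) y with hh
  have hind : Integrable (G.indicator fun _ => (1 : ℝ)) μ := (integrable_const 1).indicator hG
  have hhi : Integrable h μ := (integrable_const 1).add (hind.const_mul _)
  have hθ1 : 1 < θ⁻¹ := (one_lt_inv₀ hθ).2 h1
  have hpos : ∀ y, 0 ≤ h y := fun y => by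
    have : 0 ≤ G.indicator (fun _ => (1 : ℝ)) y := Set.indicator_nonneg (fun _ _ => zero_le_one) y
    have : 0 ≤ (θ⁻¹ - 1) * G.indicator (fun _ => (1 : ℝ)) y := mul_nonneg (by linarith) this
    simp only [hh]; linarith
  have hint : ∫ y, h y ∂μ ≤ 2 := by
    simp only [hh]
    rw [integral_add (by fun_prop) (hind.const_mul _), integral_const_mul,
      integral_indicator_const _ hG]
    simp only [integral_const, probReal_univ, smul_eq_mul, mul_one]
    have : (θ⁻¹ - 1) * μ.real G ≤ θ⁻¹ * θ := by
      have := measureReal_nonneg (μ := μ) (s := G)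
      nlinarith
    rw [inv_mul_cancel₀ hθ.ne'] at this
    linarith
  have hpow : ∫ x : Fin n → Fin k → ℝ, ∏ τ, h (x τ) ∂(sampleLaw μ n) ≤ 2 ^ n := by
    rw [sampleLaw, integral_fintype_prod_eq_pow, Fintype.card_fin]
    exact pow_le_pow_left₀ (integral_nonneg hpos) hint _
  have hpi : Integrable (fun x : Fin n → Fin k → ℝ => ∏ τ, h (x τ)) (sampleLaw μ n) :=
    Integrable.fintype_prod fun _ => hhi
  have hmk := mul_meas_ge_le_integral_of_nonneg
    (Eventually.of_forall fun x => Finset.prod_nonneg fun τ _ => hpos (x τ)) hpi (θ⁻¹ ^ r)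
  have hsub : {x : Fin n → Fin k → ℝ | (r : ℝ) ≤ cnt x G} ⊆ {x | θ⁻¹ ^ r ≤ ∏ τ, h (x τ)} := by
    intro x hx
    simp only [Set.mem_ofPred_eq] at hx ⊢
    have hx' : r ≤ (members x G).card := Nat.cast_le.1 hx
    have e : ∏ τ, h (x τ) = θ⁻¹ ^ (members x G).card := by
      have : ∀ τ, h (x τ) = if τ ∈ members x G then θ⁻¹ else 1 := fun τ => by
        by_cases hτ : x τ ∈ G <;> simp [hh, mem_members, hτ]
      simp only [this]
      simp
    rw [e]
    exact pow_le_pow_right₀ hθ1.le hx'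
  have := (mul_le_mul_of_nonneg_left (measureReal_mono (μ := sampleLaw μ n) hsub)
    (by positivity)).trans (hmk.trans hpow)
  rw [inv_pow, inv_mul_eq_div, div_le_iff₀ (by positivity)] at this
  exact this

/-! ### Approximation by finitely many boxes -/

theorem exists_grid (hcont : ∀ (i : Fin k) (t : ℝ), μ {y | y i = t} = 0) {N : ℕ} (hN : 0 < N)
    (i : Fin k) : ∃ g : ℕ → EReal, (∀ j ≤ N, μ.real (halfSpace i (g j)) = (j : ℝ) / N) ∧
      ∀ c : EReal, ∃ j < N, g j ≤ c ∧ c ≤ g (j + 1) := by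
  have hN' : (0 : ℝ) < N := by exact_mod_cast hN
  -- The extreme grid points are pinned to $\bot$ and $\top$, so that every level in `EReal` falls
  -- between two neighbours.
  have h : ∀ j : ℕ, ∃ c : EReal, (j ≤ N → μ.real (halfSpace i c) = (j : ℝ) / N) ∧
      (j = 0 → c = ⊥) ∧ (j = N → c = ⊤) := by
    intro j
    by_cases h0 : j = 0
    · subst h0
      refine ⟨⊥, fun _ => by simp [halfSpace], fun _ => rfl, fun h => absurd h.symm hN.ne'⟩
    by_cases h1 : j = N
    · subst h1
      exact ⟨⊤, fun _ => by simp [halfSpace, div_self hN'.ne'], fun h => absurd h h0, fun _ => rfl⟩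
    by_cases hj : j ≤ N
    · have hjN : (j : ℝ) ≤ N := by exact_mod_cast hj
      obtain ⟨c, hc⟩ := exists_real_inter_halfSpace_eq hcont i Set.univ (θ := (j : ℝ) / N)
        (by positivity) (by rw [probReal_univ]; exact (div_le_one hN').2 hjN)
      rw [Set.univ_inter] at hc
      exact ⟨c, fun _ => hc, fun h => absurd h h0, fun h => absurd h h1⟩
    · exact ⟨⊥, fun h => absurd h hj, fun _ => rfl, fun h => absurd h h1⟩
  choose g hg using h
  refine ⟨g, fun j => (hg j).1, fun c => ?_⟩
  by_contra! hc
  have : ∀ j ≤ N, g j ≤ c := by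
    intro j
    induction j with
    | zero => intro _; rw [(hg 0).2.1 rfl]; exact bot_le
    | succ j ih => exact fun hj => (hc j (by omega) (ih (by omega))).le
  obtain ⟨M, rfl⟩ : ∃ M, N = M + 1 := ⟨N - 1, by omega⟩
  have h2 := hc M (by omega) (this M (by omega))
  rw [(hg (M + 1)).2.2 rfl] at h2
  exact absurd h2 (not_lt.2 le_top)

/-- Every half-open box is squeezed between two members of a family of `(N + 1) ^ (2 k)` of them,
whose masses differ by at most `2 k / N`. -/
theorem exists_box_family (hcont : ∀ (i : Fin k) (t : ℝ), μ {y | y i = t} = 0) {N : ℕ}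
    (hN : 0 < N) : ∃ G : (Fin k → Fin (N + 1) × Fin (N + 1)) → Set (Fin k → ℝ),
      (∀ σ, MeasurableSet (G σ)) ∧ ∀ B, IsHBox B → ∃ σ ρ, G σ ⊆ B ∧ B ⊆ G ρ ∧
        μ.real (G ρ \ G σ) ≤ 2 * k / N := by
  choose g hg hgc using fun i => exists_grid hcont hN i
  refine ⟨fun σ => hbox (fun i => g i (σ i).1) (fun i => g i (σ i).2),
    fun σ => IsHBox.measurableSet ⟨_, _, rfl⟩, ?_⟩
  rintro B ⟨lo, hi, rfl⟩
  choose jl hjl hl1 hl2 using fun i => hgc i (lo i)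
  choose jh hjh hh1 hh2 using fun i => hgc i (hi i)
  -- The inner box rounds the lower ends up and the upper ends down; the outer box does the
  -- opposite.
  refine ⟨fun i => (⟨jl i + 1, by have := hjl i; omega⟩, ⟨jh i, by have := hjh i; omega⟩),
    fun i => (⟨jl i, by have := hjl i; omega⟩, ⟨jh i + 1, by have := hjh i; omega⟩), ?_, ?_, ?_⟩
  · exact fun y hy i => ⟨(hl2 i).trans_lt (hy i).1, (hy i).2.trans (hh1 i)⟩
  · exact fun y hy i => ⟨(hl1 i).trans_lt (hy i).1, (hy i).2.trans (hh2 i)⟩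
  · have hslab : ∀ i, ∀ j < N, g i j ≤ g i (j + 1) →
        μ.real (halfSpace i (g i (j + 1)) \ halfSpace i (g i j)) = 1 / N := by
      intro i j hj hle
      rw [measureReal_sdiff (halfSpace_mono hle) (measurableSet_halfSpace _ _), hg i _ (by omega),
        hg i _ hj.le]
      push_cast
      ring
    calc μ.real (_ \ _) ≤ μ.real (⋃ i, (halfSpace i (g i (jl i + 1)) \ halfSpace i (g i (jl i))) ∪
          (halfSpace i (g i (jh i + 1)) \ halfSpace i (g i (jh i)))) := by
          refine measureReal_mono fun y hy => ?_
          obtain ⟨h1, h2⟩ := hy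
          simp only [hbox, Set.mem_ofPred_eq, not_forall, not_and_or, not_lt, not_le] at h1 h2
          obtain ⟨i, hi'⟩ := h2
          refine Set.mem_iUnion.2 ⟨i, ?_⟩
          rcases hi' with h | h
          · exact Or.inl ⟨h, not_le.2 (h1 i).1⟩
          · exact Or.inr ⟨(h1 i).2, not_le.2 h⟩
      _ ≤ ∑ i, μ.real ((halfSpace i (g i (jl i + 1)) \ halfSpace i (g i (jl i))) ∪
          (halfSpace i (g i (jh i + 1)) \ halfSpace i (g i (jh i)))) :=
          measureReal_iUnion_fintype_le _
      _ ≤ ∑ i : Fin k, (2 / N : ℝ) := by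
          refine Finset.sum_le_sum fun i _ => (measureReal_union_le _ _).trans ?_
          rw [hslab i _ (hjl i) ((hl1 i).trans (hl2 i)), hslab i _ (hjh i) ((hh1 i).trans (hh2 i))]
          apply le_of_eq; ring
      _ = 2 * k / N := by simp; ring

theorem card_box_family (k N : ℕ) :
    (Finset.univ : Finset (Fin k → Fin (N + 1) × Fin (N + 1))).card = (N + 1) ^ (2 * k) := by
  simp [pow_mul, sq]

/-- Since $(1_G-1_S)^2=1_{G\triangle S}$, sets close to each other have a small variance proxy. This
gain makes the localized deviation bound sharper than the uniform one. -/
theorem bernstein_cnt {G S : Set (Fin k → ℝ)} (hG : MeasurableSet G) (hS : MeasurableSet S)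
    {v s : ℝ} (u : ℝ) (hv : μ.real (symmDiff G S) ≤ v) (hs0 : 0 ≤ s) (hs1 : s ≤ 1 / 2) :
    (sampleLaw μ n).real {x | u ≤ (cnt x G - n * μ.real G) - (cnt x S - n * μ.real S)} ≤
      Real.exp (-(s * u) + s ^ 2 * n * v) := by
  have hGi : Integrable (G.indicator fun _ => (1 : ℝ)) μ := (integrable_const 1).indicator hG
  have hSi : Integrable (S.indicator fun _ => (1 : ℝ)) μ := (integrable_const 1).indicator hS
  have hgm : Measurable fun y => G.indicator (fun _ => (1 : ℝ)) y - S.indicator (fun _ => 1) y :=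
    (measurable_const.indicator hG).sub (measurable_const.indicator hS)
  have hmean : ∫ y, (G.indicator (fun _ => (1 : ℝ)) y - S.indicator (fun _ => 1) y) ∂μ =
      μ.real G - μ.real S := by
    rw [integral_sub hGi hSi, integral_indicator_const _ hG, integral_indicator_const _ hS]
    simp
  have h := bernstein μ (v := v) hgm
    (fun y => by by_cases h1 : y ∈ G <;> by_cases h2 : y ∈ S <;> simp [h1, h2]) u ?_ hs0 hs1 n
  · refine le_of_eq_of_le ?_ h
    rw [hmean, sampleLaw]
    congr 1
    ext x
    simp only [Set.mem_ofPred_eq]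
    rw [Finset.sum_sub_distrib, Finset.sum_sub_distrib, ← cnt_eq_sum, ← cnt_eq_sum]
    simp only [Finset.sum_const, Finset.card_univ, Fintype.card_fin, nsmul_eq_mul]
    rw [show cnt x G - n * μ.real G - (cnt x S - n * μ.real S) =
      cnt x G - cnt x S - n * (μ.real G - μ.real S) by ring]
  · refine le_trans (le_of_eq ?_) hv
    have : ∀ y, (G.indicator (fun _ => (1 : ℝ)) y - S.indicator (fun _ => 1) y) ^ 2 =
        (symmDiff G S).indicator (fun _ => 1) y := fun y => by
      by_cases h1 : y ∈ G <;> by_cases h2 : y ∈ S <;>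
        simp [h1, h2, Set.indicator, Set.mem_symmDiff]
    simp only [this]
    rw [integral_indicator_const _ (hG.symmDiff hS)]
    simp

/-- Outside an event of small probability, all boxes that are close to `S` have about the same
deviation between empirical and true mass as `S`. -/
theorem exists_deviation_event (hcont : ∀ (i : Fin k) (t : ℝ), μ {y | y i = t} = 0)
    {S : Set (Fin k → ℝ)} (hS : MeasurableSet S) (hn : 0 < n) {η s : ℝ} (u : ℝ)
    (hs0 : 0 ≤ s) (hs1 : s ≤ 1 / 2) :
    ∃ bad : Set (Fin n → Fin k → ℝ), MeasurableSet bad ∧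
      (sampleLaw μ n).real bad ≤ ((n : ℝ) + 1) ^ (2 * k) *
        (2 * Real.exp (-(s * u) + s ^ 2 * n * (η + 2 * k / n))) ∧
      ∀ x ∉ bad, ∀ B, IsHBox B → μ.real (symmDiff B S) ≤ η →
        |(cnt x B - n * μ.real B) - (cnt x S - n * μ.real S)| ≤ u + 2 * k := by
  classical
  obtain ⟨G, hGm, hG⟩ := exists_box_family (μ := μ) hcont hn
  have hn' : (0 : ℝ) < n := by exact_mod_cast hn
  -- Only grid boxes near $S$ enter the union bound. The extra $2k/n$ admits both boxes squeezing
  -- any $B$ within $\eta$ of $S$.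
  set I := (Finset.univ : Finset (Fin k → Fin (n + 1) × Fin (n + 1))).filter
    fun σ => μ.real (symmDiff (G σ) S) ≤ η + 2 * k / n with hI
  let E : (Fin k → Fin (n + 1) × Fin (n + 1)) → Set (Fin n → Fin k → ℝ) := fun σ =>
    {x | u ≤ (cnt x (G σ) - n * μ.real (G σ)) - (cnt x S - n * μ.real S)} ∪
    {x | u ≤ (cnt x S - n * μ.real S) - (cnt x (G σ) - n * μ.real (G σ))}
  refine ⟨⋃ σ ∈ I, E σ, ?_, ?_, ?_⟩
  · refine Finset.measurableSet_biUnion _ fun σ _ => MeasurableSet.union ?_ ?_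
    · exact measurableSet_le measurable_const (((measurable_cnt (hGm σ)).sub_const _).sub
        ((measurable_cnt hS).sub_const _))
    · exact measurableSet_le measurable_const (((measurable_cnt hS).sub_const _).sub
        ((measurable_cnt (hGm σ)).sub_const _))
  · calc (sampleLaw μ n).real (⋃ σ ∈ I, E σ) ≤ ∑ σ ∈ I, (sampleLaw μ n).real (E σ) :=
          measureReal_biUnion_finset_le _ _
      _ ≤ ∑ σ ∈ I, 2 * Real.exp (-(s * u) + s ^ 2 * n * (η + 2 * k / n)) := by
          refine Finset.sum_le_sum fun σ hσ => (measureReal_union_le _ _).trans ?_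
          have hσ' := (Finset.mem_filter.1 hσ).2
          rw [two_mul]
          exact add_le_add (bernstein_cnt (hGm σ) hS u hσ' hs0 hs1)
            (bernstein_cnt hS (hGm σ) u (by rwa [symmDiff_comm]) hs0 hs1)
      _ ≤ _ := by
          rw [Finset.sum_const, nsmul_eq_mul]
          refine mul_le_mul_of_nonneg_right ?_ (by positivity)
          have := (Finset.card_filter_le (Finset.univ : Finset (Fin k → Fin (n + 1) × Fin (n + 1)))
            (fun σ => μ.real (symmDiff (G σ) S) ≤ η + 2 * k / n)).trans_eq (card_box_family k n)
          rw [← hI] at this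
          exact_mod_cast this
  · intro x hx B hB hη
    obtain ⟨σ, ρ, h1, h2, h3⟩ := hG B hB
    have hgood : ∀ ξ, G σ ⊆ G ξ → G ξ ⊆ G ρ →
        |(cnt x (G ξ) - n * μ.real (G ξ)) - (cnt x S - n * μ.real S)| ≤ u := by
      intro ξ hξ1 hξ2
      have hξ : ξ ∈ I := by
        refine Finset.mem_filter.2 ⟨Finset.mem_univ _, ?_⟩
        calc μ.real (symmDiff (G ξ) S) ≤ μ.real (symmDiff B S ∪ (G ρ \ G σ)) := by
              refine measureReal_mono fun y => ?_
              simp only [Set.mem_symmDiff, Set.mem_union, Set.mem_sdiff]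
              have := @h1 y; have := @h2 y; have := @hξ1 y; have := @hξ2 y
              tauto
          _ ≤ _ := (measureReal_union_le _ _).trans (add_le_add hη h3)
      have hnot : x ∉ E ξ := fun h => hx (Set.mem_biUnion hξ h)
      simp only [E, Set.mem_union, Set.mem_ofPred_eq, not_or, not_le] at hnot
      exact abs_le.2 ⟨by linarith [hnot.2], hnot.1.le⟩
    have hσ := abs_le.1 (hgood σ subset_rfl (h1.trans h2))
    have hρ := abs_le.1 (hgood ρ (h1.trans h2) subset_rfl)
    have c1 := cnt_mono x h1
    have c2 := cnt_mono x h2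
    have m1 := measureReal_mono (μ := μ) h1
    have m2 := measureReal_mono (μ := μ) h2
    rw [measureReal_sdiff (h1.trans h2) (hGm σ), le_div_iff₀ hn'] at h3
    -- Mesh $1/n$ costs mass $2k/n$, that is, $2k$ in expected counts.
    have e1 : n * μ.real (G ρ) ≤ n * μ.real B + 2 * k := by nlinarith
    have e2 : n * μ.real B ≤ n * μ.real (G σ) + 2 * k := by nlinarith
    rw [abs_le]
    constructor <;> linarith [hσ.1, hρ.2]

/-- Outside an event of small probability, no box of mass at most `t` contains `r` sample
points. -/
theorem exists_small_box_event (hcont : ∀ (i : Fin k) (t : ℝ), μ {y | y i = t} = 0)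
    {t : ℝ} (ht : 0 < t) (ht1 : t ≤ 1) (r : ℕ) :
    ∃ bad : Set (Fin n → Fin k → ℝ), MeasurableSet bad ∧
      (sampleLaw μ n).real bad ≤ (3 / t) ^ (2 * k) * (2 ^ n * ((1 + 2 * k) * t) ^ r) ∧
      ∀ x ∉ bad, ∀ B, IsHBox B → μ.real B ≤ t → cnt x B < r := by
  classical
  -- With mesh comparable to $t$, the outer box of a box of mass at most $t$ has mass at most
  -- $(1+2k)t$, and the family has at most $(3/t)^{2k}$ members.
  set N := ⌈1 / t⌉₊ with hN
  have hN0 : 0 < N := Nat.ceil_pos.2 (by positivity)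
  have hN' : (0 : ℝ) < N := by exact_mod_cast hN0
  have hN1 : 1 / t ≤ N := Nat.le_ceil _
  have hN2 : (N : ℝ) + 1 ≤ 3 / t := by
    have h1 := (Nat.ceil_lt_add_one (by positivity : (0 : ℝ) ≤ 1 / t)).le
    have h2 : 1 ≤ 1 / t := (one_le_div ht).2 ht1
    calc (N : ℝ) + 1 ≤ 1 / t + 1 / t + 1 / t := by linarith
      _ = 3 / t := by ring
  have hNt : 2 * (k : ℝ) / N ≤ 2 * k * t := by
    rw [div_le_iff₀ hN']
    rw [div_le_iff₀ ht] at hN1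
    nlinarith [(Nat.cast_nonneg k : (0 : ℝ) ≤ k)]
  obtain ⟨G, hGm, hG⟩ := exists_box_family (μ := μ) hcont hN0
  set I := (Finset.univ : Finset (Fin k → Fin (N + 1) × Fin (N + 1))).filter
    fun σ => μ.real (G σ) ≤ (1 + 2 * k) * t with hI
  refine ⟨⋃ σ ∈ I, {x | (r : ℝ) ≤ cnt x (G σ)}, ?_, ?_, ?_⟩
  · exact Finset.measurableSet_biUnion _ fun σ _ =>
      measurableSet_le measurable_const (measurable_cnt (hGm σ))
  · calc (sampleLaw μ n).real (⋃ σ ∈ I, {x | (r : ℝ) ≤ cnt x (G σ)})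
        ≤ ∑ σ ∈ I, (sampleLaw μ n).real {x | (r : ℝ) ≤ cnt x (G σ)} :=
          measureReal_biUnion_finset_le _ _
      _ ≤ ∑ σ ∈ I, 2 ^ n * ((1 + 2 * k) * t) ^ r := Finset.sum_le_sum fun σ hσ =>
          chernoff_cnt (hGm σ) (by positivity) (Finset.mem_filter.1 hσ).2 r
      _ ≤ _ := by
          rw [Finset.sum_const, nsmul_eq_mul]
          refine mul_le_mul_of_nonneg_right ?_ (by positivity)
          have := (Finset.card_filter_le (Finset.univ : Finset (Fin k → Fin (N + 1) × Fin (N + 1)))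
            (fun σ => μ.real (G σ) ≤ (1 + 2 * k) * t)).trans_eq (card_box_family k N)
          rw [← hI] at this
          calc (I.card : ℝ) ≤ ((N : ℝ) + 1) ^ (2 * k) := by exact_mod_cast this
            _ ≤ _ := by gcongr
  · intro x hx B hB hBt
    obtain ⟨σ, ρ, h1, h2, h3⟩ := hG B hB
    refine (cnt_mono x h2).trans_lt ?_
    by_contra! hc
    refine hx (Set.mem_biUnion (x := ρ) (Finset.mem_filter.2 ⟨Finset.mem_univ _, ?_⟩) hc)
    rw [measureReal_sdiff (h1.trans h2) (hGm σ)] at h3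
    have := measureReal_mono (μ := μ) h1
    linarith

/-- The variance of an empirical frequency. -/
theorem integral_cnt_div_sub_sq {S : Set (Fin k → ℝ)} (hS : MeasurableSet S) (hn : 0 < n) :
    ∫ x, (cnt x S / n - μ.real S) ^ 2 ∂(sampleLaw μ n) = μ.real S * (1 - μ.real S) / n := by
  have hn' : (n : ℝ) ≠ 0 := by exact_mod_cast hn.ne'
  have hm : Measurable (S.indicator fun _ => (1 : ℝ)) := measurable_const.indicator hS
  have hSi : Integrable (S.indicator fun _ => (1 : ℝ)) μ := (integrable_const 1).indicator hS
  have hL : MemLp (S.indicator fun _ => (1 : ℝ)) 2 μ :=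
    MemLp.of_bound hm.aestronglyMeasurable 1 (Eventually.of_forall fun y => by
      by_cases h : y ∈ S <;> simp [h])
  have hmean : ∫ y, S.indicator (fun _ => (1 : ℝ)) y ∂μ = μ.real S := by
    rw [integral_indicator_const _ hS]; simp
  have hvar : ProbabilityTheory.variance (S.indicator fun _ => (1 : ℝ)) μ =
      μ.real S * (1 - μ.real S) := by
    rw [ProbabilityTheory.variance_eq_sub hL]
    have : (S.indicator fun _ => (1 : ℝ)) ^ 2 = S.indicator fun _ => (1 : ℝ) := by
      ext y; by_cases h : y ∈ S <;> simp [h]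
    rw [this, hmean]; ring
  have hsum := ProbabilityTheory.variance_sum_pi (μ := fun _ : Fin n => μ)
    (X := fun _ => S.indicator fun _ => (1 : ℝ)) (fun _ => hL)
  simp only [hvar, Finset.sum_const, Finset.card_univ, Fintype.card_fin, nsmul_eq_mul] at hsum
  have hc : (∑ i : Fin n, fun ω : Fin n → Fin k → ℝ => S.indicator (fun _ => (1 : ℝ)) (ω i)) =
      fun x => cnt x S := by
    ext x; simp [cnt_eq_sum]
  rw [hc, ProbabilityTheory.variance_eq_integral (measurable_cnt hS).aemeasurable] at hsum
  have hE : ∫ x, cnt x S ∂(Measure.pi fun _ : Fin n => μ) = n * μ.real S := by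
    simp only [cnt_eq_sum]
    rw [integral_finsetSum]
    · have : ∀ τ : Fin n, ∫ x : Fin n → Fin k → ℝ, S.indicator (fun _ => (1 : ℝ)) (x τ)
          ∂(Measure.pi fun _ => μ) = μ.real S := fun τ => by
        rw [integral_comp_eval hSi.aestronglyMeasurable, hmean]
      simp [this]
    · exact fun τ _ => integrable_comp_eval hSi
  rw [hE] at hsum
  have : ∀ x : Fin n → Fin k → ℝ, (cnt x S / n - μ.real S) ^ 2 =
      ((n : ℝ) ^ 2)⁻¹ * (cnt x S - n * μ.real S) ^ 2 := fun x => by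
    field_simp
  simp only [this]
  rw [integral_const_mul, sampleLaw, hsum]
  field_simp

end Counts

/-! ### The regions of a sample are close to the population regions -/

section Closeness

variable {k n : ℕ} {μ : Measure (Fin k → ℝ)} [IsProbabilityMeasure μ]
  {a b : Fin k → EReal} {x : Fin n → Fin k → ℝ}

/-- The constant in the bound for the distance of the sample regions of depth `j` to the population
regions. -/
def closeConst : ℕ → ℝ
  | 0 => 0
  | j + 1 => 3 * closeConst j + 2 * (j + 2)

theorem closeConst_nonneg (j : ℕ) : 0 ≤ closeConst j := by
  induction j with
  | zero => simp [closeConst]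
  | succ j ih => simp only [closeConst]; positivity

theorem cnt_inter_innerBox (hx : Generic a b x) (A : Set (Fin k → ℝ)) :
    cnt x (A ∩ innerBox a b) = cnt x A := by
  unfold cnt
  rw [members_congr fun τ => ?_]
  simp [hx.mem τ]

theorem real_inter_innerBox {μ : Measure (Fin k → ℝ)} (hin : ∀ᵐ y ∂μ, y ∈ innerBox a b) (A : Set (Fin k → ℝ)) :
    μ.real (A ∩ innerBox a b) = μ.real A :=
  measureReal_congr (by
    filter_upwards [hin] with y hy
    exact propext ⟨fun h => h.1, fun h => ⟨h, hy⟩⟩)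

theorem abs_real_sub_real_le (A B : Set (Fin k → ℝ)) :
    |μ.real A - μ.real B| ≤ μ.real (symmDiff A B) := by
  have h1 : μ.real A ≤ μ.real B + μ.real (symmDiff A B) :=
    (measureReal_mono fun y hy => by
      by_cases h : y ∈ B
      · exact Or.inl h
      · exact Or.inr (Or.inl ⟨hy, h⟩)).trans (measureReal_union_le _ _)
  have h2 : μ.real B ≤ μ.real A + μ.real (symmDiff A B) :=
    (measureReal_mono fun y hy => by
      by_cases h : y ∈ A
      · exact Or.inl h
      · exact Or.inr (Or.inr ⟨hy, h⟩)).trans (measureReal_union_le _ _)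
  exact abs_le.2 ⟨by linarith, by linarith⟩

/-- Half spaces in one coordinate are nested, so comparing masses suffices. Cut points themselves
need not be close, as $\mu$ may have gaps. -/
theorem real_inter_symmDiff_halfSpace {A : Set (Fin k → ℝ)} (hA : MeasurableSet A) (i : Fin k)
    (c c' : EReal) : μ.real (A ∩ symmDiff (halfSpace i c) (halfSpace i c')) =
      |μ.real (A ∩ halfSpace i c) - μ.real (A ∩ halfSpace i c')| := by
  wlog h : c ≤ c' generalizing c c'
  · rw [symmDiff_comm, abs_sub_comm]
    exact this c' c (le_of_not_ge h)
  have hsub : A ∩ halfSpace i c ⊆ A ∩ halfSpace i c' :=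
    Set.inter_subset_inter_right A (halfSpace_mono h)
  have : A ∩ symmDiff (halfSpace i c) (halfSpace i c') =
      (A ∩ halfSpace i c') \ (A ∩ halfSpace i c) := by
    ext y
    have := @halfSpace_mono k i c c' h y
    simp only [Set.mem_inter_iff, Set.mem_symmDiff, Set.mem_sdiff]
    tauto
  rw [this, measureReal_sdiff hsub (hA.inter (measurableSet_halfSpace i c)), abs_sub_comm,
    abs_of_nonneg (sub_nonneg.2 (measureReal_mono hsub))]

theorem symmDiff_slab_subset {E : Type*} (A B I P P' Q Q' : Set E) :
    symmDiff (A ∩ (P' \ P) ∩ I) (B ∩ (Q' \ Q)) ⊆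
      symmDiff (A ∩ I) B ∪ (B ∩ symmDiff P' Q' ∪ B ∩ symmDiff P Q) := by
  intro y
  simp only [Set.mem_symmDiff, Set.mem_inter_iff, Set.mem_sdiff, Set.mem_union]
  tauto

/-- Induction on depth. The sample cut captures the fraction $\theta$ of the points of $A$ up to
rounding, hence by `hdev` nearly the mass $\theta m$. Passing from $A$ to the population cell $A_0$
costs the distance at the previous depth, and the quantile cut has mass exactly $\theta m$ in $A_0$.
The parent's distance plus the errors of two cuts gives the recursion of `closeConst`. -/
theorem real_symmDiff_popCell_le (hcont : ∀ (i : Fin k) (t : ℝ), μ {y | y i = t} = 0)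
    (hin : ∀ᵐ y ∂μ, y ∈ innerBox a b) (p : List ℕ → ℕ) (hx : Generic a b x) (hn : 0 < n)
    {ρ : ℝ} (hρ : 1 / n ≤ ρ) (hdev : ∀ B, IsHBox B → |cnt x B - n * μ.real B| ≤ n * ρ)
    {j : ℕ} (hj : j ≤ k) {J : List ℕ} (hJ : J ∈ cells p j) :
    μ.real (symmDiff (region a b p x J ∩ innerBox a b) (popCell μ p J)) ≤ closeConst j * ρ := by
  have hn' : (0 : ℝ) < n := by exact_mod_cast hn
  have habs : ∀ t : ℝ, |n * t| = n * |t| := fun t => by rw [abs_mul, abs_of_pos hn']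
  have hnρ : 1 ≤ n * ρ := by rwa [div_le_iff₀' hn'] at hρ
  induction j generalizing J with
  | zero =>
    simp only [cells, Finset.mem_singleton] at hJ
    subst hJ
    have : symmDiff (region a b p x [] ∩ innerBox a b) (popCell μ p []) ⊆ (innerBox a b)ᶜ := by
      intro y hy
      simp only [popCell, Set.mem_symmDiff, Set.mem_inter_iff, Set.mem_univ, not_true_eq_false,
        and_false, true_and, false_or] at hy
      exact fun hy' => hy ⟨fun i => ⟨(hy' i).1.le, (hy' i).2⟩, hy'⟩
    have h0 : μ.real (innerBox a b)ᶜ = 0 := by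
      rw [measureReal_def, show μ (innerBox a b)ᶜ = 0 from hin]; rfl
    simp only [closeConst, zero_mul]
    exact (measureReal_mono this).trans h0.le
  | succ j ih =>
    obtain ⟨K, hK, s, hs, rfl⟩ := mem_cells_succ.1 hJ
    have hlen := length_of_mem_cells hK
    have hKk : K.length < k := by omega
    have hδ := ih (by omega) hK
    have hN := abs_card_members_sub_le hx p (show j ≤ k by omega) hK
    set i : Fin k := ⟨K.length, hKk⟩ with hi
    set A := region a b p x K with hA
    set A₀ := popCell μ p K with hA₀
    have hRbox : IsHBox (A ∩ innerBox a b) := isHBox_region_inter_innerBox a b p x hKk.le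
    have hA₀m : MeasurableSet A₀ := measurableSet_popCell μ p hKk.le
    have hcut : ∀ t ≤ p K + 1, μ.real (A₀ ∩ symmDiff
        (halfSpace i (cutPoint (a i) (b i) (fun τ => x τ i) (members x A) (p K) t))
        (halfSpace i (quantileCut μ A₀ i ((t : ℝ) / ((p K : ℝ) + 1))))) ≤
        closeConst j * ρ + (j + 2) * ρ := by
      intro t ht
      have hq : (0 : ℝ) < (p K : ℝ) + 1 := by positivity
      have ht' : (t : ℝ) ≤ p K + 1 := by exact_mod_cast ht
      have hθ1 : (t : ℝ) / ((p K : ℝ) + 1) ≤ 1 := (div_le_one hq).2 ht'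
      have hθ0 : 0 ≤ (t : ℝ) / ((p K : ℝ) + 1) := by positivity
      rw [real_inter_symmDiff_halfSpace hA₀m, real_inter_quantileCut hcont A₀ i hθ0 hθ1,
        hA₀, real_popCell hcont p (by omega) hK, ← hA₀]
      have hcard := card_members_inter_halfSpace hx p hKk ht
      rw [← hi, ← hA] at hcard
      generalize cutPoint (a i) (b i) (fun τ => x τ i) (members x A) (p K) t = c at hcard ⊢
      obtain ⟨f1, f2⟩ := abs_floor_sub_le (members x A).card t (p K)
      rw [← hcard] at f1 f2
      set θ := (t : ℝ) / ((p K : ℝ) + 1)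
      have hbox : IsHBox (A ∩ halfSpace i c ∩ innerBox a b) := by
        rw [Set.inter_right_comm]
        exact hRbox.inter (isHBox_halfSpace i c)
      have d1 := hdev _ hbox
      rw [cnt_inter_innerBox hx] at d1
      have d2 : |μ.real (A₀ ∩ halfSpace i c) - μ.real (A ∩ halfSpace i c ∩ innerBox a b)| ≤
          closeConst j * ρ := by
        refine (abs_real_sub_real_le _ _).trans (le_trans (measureReal_mono ?_) hδ)
        intro y
        simp only [Set.mem_symmDiff, Set.mem_inter_iff]
        tauto
      have d3 : |cnt x (A ∩ halfSpace i c) - n * (θ * estMass p K)| ≤ 1 + j := by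
        have e1 : |cnt x (A ∩ halfSpace i c) - (members x A).card * θ| ≤ 1 := by
          rw [abs_le]; unfold cnt; constructor <;> linarith
        have e2 : |((members x A).card : ℝ) * θ - n * (θ * estMass p K)| ≤ j := by
          have : ((members x A).card : ℝ) * θ - n * (θ * estMass p K) =
            θ * ((members x A).card - n * estMass p K) := by ring
          rw [this, abs_mul, abs_of_nonneg hθ0]
          exact (mul_le_of_le_one_left (abs_nonneg _) hθ1).trans hN
        exact (abs_sub_le _ _ _).trans (add_le_add e1 e2)
      have d4 : |μ.real (A ∩ halfSpace i c ∩ innerBox a b) - θ * estMass p K| ≤ (j + 2) * ρ := by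
        have : n * |μ.real (A ∩ halfSpace i c ∩ innerBox a b) - θ * estMass p K| ≤
            n * ((j + 2) * ρ) := by
          rw [← habs]
          rw [abs_le] at d1 d3 ⊢
          have : (j : ℝ) + 1 ≤ (j + 1) * (n * ρ) := le_mul_of_one_le_right (by positivity) hnρ
          constructor <;> nlinarith [d1.1, d1.2, d3.1, d3.2]
        exact le_of_mul_le_mul_left this hn'
      exact (abs_sub_le _ _ _).trans (add_le_add d2 d4)
    have h1 := hcut (s + 1) (by omega)
    have h2 := hcut s (by omega)
    rw [region_cons a b p x s hKk, popCell_cons μ p s hKk, ← hi, ← hA, ← hA₀]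
    calc _ ≤ closeConst j * ρ + ((closeConst j * ρ + (j + 2) * ρ) +
          (closeConst j * ρ + (j + 2) * ρ)) :=
        (measureReal_mono (symmDiff_slab_subset _ _ _ _ _ _ _)).trans ((measureReal_union_le _ _).trans (add_le_add hδ
          ((measureReal_union_le _ _).trans (add_le_add h1 h2))))
      _ = closeConst (j + 1) * ρ := by simp only [closeConst]; ring

end Closeness

/-! ### The good event -/

section GoodEvent

variable {k : ℕ} {μ : Measure (Fin k → ℝ)} [IsProbabilityMeasure μ] {a b : Fin k → EReal}

/-- The scale `n ^ (1 / 16)`. -/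
noncomputable def scale (n : ℕ) : ℝ := (n : ℝ) ^ (1 / 16 : ℝ)

theorem scale_pow (n : ℕ) : scale n ^ 16 = n := by
  rw [scale, ← Real.rpow_natCast, ← Real.rpow_mul (Nat.cast_nonneg n)]
  norm_num

theorem tendsto_scale : Tendsto scale atTop atTop :=
  (tendsto_rpow_atTop (by norm_num)).comp tendsto_natCast_atTop_atTop

theorem cnt_empty {n : ℕ} (x : Fin n → Fin k → ℝ) : cnt x ∅ = 0 := by
  simp [cnt_eq_sum]

/-- Write $z=n^{1/16}$. Uniform deviation of counts is at most of order $z^9$, so masses are within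
order $z^{-7}$. Among boxes within mass $O(z^{-7})$ of a population cell the deviations differ by
only $O(z^6)$, that is, $z^{-10}$ after division by $n$. The exponents are chosen so that
$z^{-7}z^{-10}=z^{-17}=o(1/n)$. -/
theorem exists_good_event (hsupp : ∀ᵐ y ∂μ, y ∈ box a b)
    (hcont : ∀ (i : Fin k) (t : ℝ), μ {y | y i = t} = 0) {l : ℕ} (hl : l ≤ k) (p : List ℕ → ℕ) :
    ∃ C : ℝ, 0 < C ∧ ∀ᶠ n : ℕ in atTop, ∃ bad : Set (Fin n → Fin k → ℝ), MeasurableSet bad ∧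
      (sampleLaw μ n).real bad ≤ 1 / scale n ^ 17 ∧
      ∀ x ∉ bad, Generic a b x → ∀ J ∈ cells p l,
        |trueMass a b p μ x J - estMass p J| ≤ C / scale n ^ 7 ∧
        |(trueMass a b p μ x J - estMass p J) + (cnt x (popCell μ p J) / n - estMass p J)| ≤
          C / scale n ^ 10 := by
  have hin := ae_mem_innerBox hsupp hcont
  set D : ℝ := closeConst l * (1 + 2 * k) with hD
  have hD0 : 0 ≤ D := mul_nonneg (closeConst_nonneg l) (by positivity)
  set Q : ℝ := 4 ^ k * (1 + (cells p l).card) * (2 * Real.exp (1 + D + 2 * k)) with hQ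
  have hQ0 : 0 < Q := by positivity
  refine ⟨1 + 2 * k + l, by positivity, ?_⟩
  -- Each tail is of order $e^{-z}$, which absorbs the $O(z^{32k})$ grid boxes and still leaves
  -- $z^{-17}$.
  have hexp : ∀ᶠ n : ℕ in atTop, scale n ^ (32 * k + 17) * Real.exp (-scale n) < 1 / Q :=
    ((Real.tendsto_pow_mul_exp_neg_atTop_nhds_zero _).comp tendsto_scale).eventually
      (gt_mem_nhds (by positivity))
  filter_upwards [hexp, tendsto_scale.eventually_ge_atTop 2, eventually_gt_atTop 0]
    with n hexp hz hn
  set z := scale n with hzdef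
  have hzn : (n : ℝ) = z ^ 16 := (scale_pow n).symm
  have hn' : (0 : ℝ) < n := by exact_mod_cast hn
  have habs : ∀ t : ℝ, |n * t| = n * |t| := fun t => by rw [abs_mul, abs_of_pos hn']
  have hz0 : 0 < z := by linarith
  have hz1 : 1 ≤ z := by linarith
  have hzp : ∀ m, 1 ≤ z ^ m := fun m => one_le_pow₀ hz1
  have hn1 : (1 : ℝ) ≤ n := by rw [hzn]; exact hzp 16
  have hk0 : (0 : ℝ) ≤ 2 * k := by positivity
  -- With $S=\emptyset$ and $\eta=1$ every box qualifies, so this is the uniform deviation bound.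
  obtain ⟨bad₀, hbm₀, hbp₀, hb₀⟩ := exists_deviation_event (μ := μ) (n := n) hcont
    MeasurableSet.empty hn (η := 1) (s := 1 / z ^ 8) (z ^ 9) (by positivity) (by
      rw [div_le_div_iff₀ (by positivity) (by norm_num)]
      have : z ^ 1 ≤ z ^ 8 := pow_le_pow_right₀ hz1 (by norm_num)
      linarith)
  -- The local bound near each population cell: variance $O(z^{-7})$ permits threshold $z^6$ with
  -- $s=z^{-5}$, because $s^2nz^{-7}=z^{-1}$.
  have hloc : ∀ J : List ℕ, ∃ bad : Set (Fin n → Fin k → ℝ), J ∈ cells p l → MeasurableSet bad ∧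
      (sampleLaw μ n).real bad ≤ ((n : ℝ) + 1) ^ (2 * k) * (2 * Real.exp (-(1 / z ^ 5 * z ^ 6) +
        (1 / z ^ 5) ^ 2 * n * (D / z ^ 7 + 2 * k / n))) ∧
      ∀ x ∉ bad, ∀ B, IsHBox B → μ.real (symmDiff B (popCell μ p J)) ≤ D / z ^ 7 →
        |(cnt x B - n * μ.real B) - (cnt x (popCell μ p J) - n * μ.real (popCell μ p J))| ≤
          z ^ 6 + 2 * k := by
    intro J
    by_cases hJ : J ∈ cells p l
    · obtain ⟨bad, h⟩ := exists_deviation_event (μ := μ) (n := n) hcont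
        (measurableSet_popCell μ p (J := J) (by rw [length_of_mem_cells hJ]; exact hl)) hn
        (η := D / z ^ 7) (s := 1 / z ^ 5) (z ^ 6) (by positivity) (by
          rw [div_le_div_iff₀ (by positivity) (by norm_num)]
          have : z ^ 1 ≤ z ^ 5 := pow_le_pow_right₀ hz1 (by norm_num)
          linarith)
      exact ⟨bad, fun _ => h⟩
    · exact ⟨∅, fun h => absurd h hJ⟩
  choose bad hbad using hloc
  have hgrid : ((n : ℝ) + 1) ^ (2 * k) ≤ 4 ^ k * z ^ (32 * k) := by
    calc ((n : ℝ) + 1) ^ (2 * k) ≤ (2 * n) ^ (2 * k) := by gcongr; linarith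
      _ = 4 ^ k * z ^ (32 * k) := by
        rw [hzn, mul_pow, pow_mul 2 2 k, ← pow_mul z, show 16 * (2 * k) = 32 * k by ring]; norm_num
  have hpw : ∀ {s u v : ℝ}, -(s * u) + v ≤ -z + (1 + D + 2 * k) →
      ((n : ℝ) + 1) ^ (2 * k) * (2 * Real.exp (-(s * u) + v)) ≤
      4 ^ k * z ^ (32 * k) * (2 * (Real.exp (1 + D + 2 * k) * Real.exp (-z))) := by
    intro s u v h
    refine mul_le_mul hgrid ?_ (by positivity) (by positivity)
    rw [← Real.exp_add]
    exact mul_le_mul_of_nonneg_left (Real.exp_le_exp.2 (by linarith)) (by norm_num)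
  have hp₀ : (sampleLaw μ n).real bad₀ ≤
      4 ^ k * z ^ (32 * k) * (2 * (Real.exp (1 + D + 2 * k) * Real.exp (-z))) := by
    refine hbp₀.trans (hpw ?_)
    have e1 : 1 / z ^ 8 * z ^ 9 = z := by field_simp
    have e2 : (1 / z ^ 8) ^ 2 * n * (1 + 2 * k / n) = 1 + 2 * k / n := by
      rw [hzn]; field_simp
    have e3 : 2 * (k : ℝ) / n ≤ 2 * k := div_le_self hk0 hn1
    rw [e1, e2]; linarith
  have hpJ : ∀ J ∈ cells p l, (sampleLaw μ n).real (bad J) ≤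
      4 ^ k * z ^ (32 * k) * (2 * (Real.exp (1 + D + 2 * k) * Real.exp (-z))) := by
    intro J hJ
    refine (hbad J hJ).2.1.trans (hpw ?_)
    have e1 : 1 / z ^ 5 * z ^ 6 = z := by field_simp
    have e2 : (1 / z ^ 5) ^ 2 * n * (D / z ^ 7 + 2 * k / n) = D / z + 2 * k / z ^ 10 := by
      rw [hzn]; field_simp
    have e3 : 2 * (k : ℝ) / z ^ 10 ≤ 2 * k := div_le_self hk0 (hzp 10)
    have e4 : D / z ≤ D := div_le_self hD0 hz1
    rw [e1, e2]; linarith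
  refine ⟨bad₀ ∪ ⋃ J ∈ cells p l, bad J, hbm₀.union (Finset.measurableSet_biUnion _ fun J hJ =>
    (hbad J hJ).1), ?_, ?_⟩
  · calc (sampleLaw μ n).real (bad₀ ∪ ⋃ J ∈ cells p l, bad J)
        ≤ (sampleLaw μ n).real bad₀ + ∑ J ∈ cells p l, (sampleLaw μ n).real (bad J) :=
          (measureReal_union_le _ _).trans
            (add_le_add le_rfl (measureReal_biUnion_finset_le _ _))
      _ ≤ (1 + (cells p l).card) *
          (4 ^ k * z ^ (32 * k) * (2 * (Real.exp (1 + D + 2 * k) * Real.exp (-z)))) := by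
          rw [add_mul, one_mul, ← nsmul_eq_mul]
          exact add_le_add hp₀ (Finset.sum_le_card_nsmul _ _ _ hpJ)
      _ = Q * (z ^ (32 * k + 17) * Real.exp (-z)) / z ^ 17 := by
          rw [hQ, pow_add]; field_simp
      _ ≤ 1 / z ^ 17 := by
          rw [lt_div_iff₀' hQ0] at hexp
          gcongr
  · intro x hx hgen J hJ
    rw [Set.mem_union, not_or] at hx
    have hxJ : x ∉ bad J := fun h => hx.2 (Set.mem_biUnion hJ h)
    have hnz : (n : ℝ) * ((1 + 2 * k) / z ^ 7) = (1 + 2 * k) * z ^ 9 := by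
      rw [hzn]; field_simp
    have hdev : ∀ B, IsHBox B → |cnt x B - n * μ.real B| ≤ n * ((1 + 2 * k) / z ^ 7) := by
      intro B hB
      have h := hb₀ x hx.1 B hB measureReal_le_one
      rw [cnt_empty, measureReal_empty, mul_zero, sub_zero, sub_zero] at h
      rw [hnz]
      nlinarith [hzp 9]
    have hρ : 1 / (n : ℝ) ≤ (1 + 2 * k) / z ^ 7 := by
      rw [div_le_iff₀' hn', hnz]
      nlinarith [hzp 9]
    have hclose := real_symmDiff_popCell_le hcont hin p hgen hn hρ hdev hl hJ
    have hbox : IsHBox (region a b p x J ∩ innerBox a b) :=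
      isHBox_region_inter_innerBox a b p x (by rw [length_of_mem_cells hJ]; exact hl)
    have hloc := (hbad J hJ).2.2 x hxJ _ hbox (hclose.trans_eq (by rw [hD]; ring))
    have hd := hdev _ hbox
    have hN := abs_card_members_sub_le hgen p hl hJ
    rw [cnt_inter_innerBox hgen, real_inter_innerBox hin] at hd hloc
    rw [real_popCell hcont p hl hJ] at hloc
    change |cnt x (region a b p x J) - n * estMass p J| ≤ l at hN
    change |cnt x (region a b p x J) - n * trueMass a b p μ x J| ≤ _ at hd
    change |cnt x (region a b p x J) - n * trueMass a b p μ x J - _| ≤ _ at hloc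
    generalize cnt x (region a b p x J) = N at *
    generalize trueMass a b p μ x J = M at *
    set m := estMass p J
    set Y := cnt x (popCell μ p J)
    have hl9 : (l : ℝ) ≤ l * z ^ 9 := le_mul_of_one_le_right (by positivity) (hzp 9)
    have hl6 : (l : ℝ) ≤ l * z ^ 6 := le_mul_of_one_le_right (by positivity) (hzp 6)
    have hk6 : 2 * (k : ℝ) ≤ 2 * k * z ^ 6 := le_mul_of_one_le_right (by positivity) (hzp 6)
    constructor
    · have e : (n : ℝ) * ((1 + 2 * k + l) / z ^ 7) = (1 + 2 * k + l) * z ^ 9 := by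
        rw [hzn]; field_simp
      refine le_of_mul_le_mul_left ?_ hn'
      rw [e, ← habs]
      rw [hnz] at hd
      rw [abs_le] at hN hd ⊢
      constructor <;> linarith [hN.1, hN.2, hd.1, hd.2]
    · have e : (n : ℝ) * ((1 + 2 * k + l) / z ^ 10) = (1 + 2 * k + l) * z ^ 6 := by
        rw [hzn]; field_simp
      refine le_of_mul_le_mul_left ?_ hn'
      rw [e, ← habs]
      have e2 : (n : ℝ) * (M - m + (Y / n - m)) = n * M - n * m + (Y - n * m) := by
        field_simp
      rw [e2]
      rw [abs_le] at hN hloc ⊢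
      constructor <;> linarith [hN.1, hN.2, hloc.1, hloc.2]

end GoodEvent

/-! ### Small true masses -/

section LowerTail

variable {k : ℕ} {μ : Measure (Fin k → ℝ)} [IsProbabilityMeasure μ] {a b : Fin k → EReal}

/-- A region holds about $nm$ points, so mass at most $t$ forces some box of mass at most $t$ to
hold $r=\lfloor nm/2\rfloor$ points. In the resulting bound $(3/t)^{2k}2^n((1+2k)t)^r$, the first
$2k+R+1$ powers of $t$ cancel $t^{-2k}$ and leave $t^{R+1}$; the others are bounded by powers of
$\delta$, which beat $2^n$. -/
theorem exists_lower_tail_bound (hsupp : ∀ᵐ y ∂μ, y ∈ box a b)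
    (hcont : ∀ (i : Fin k) (t : ℝ), μ {y | y i = t} = 0) {l : ℕ} (hl : l ≤ k) (p : List ℕ → ℕ)
    {J : List ℕ} (hJ : J ∈ cells p l) (R : ℕ) {δmax : ℝ} (hδ : 0 < δmax) :
    ∃ δ K : ℝ, 0 < δ ∧ δ ≤ δmax ∧ 0 < K ∧ ∀ᶠ n : ℕ in atTop, ∀ t, 0 < t → t ≤ δ →
      (sampleLaw μ n).real {x | trueMass a b p μ x J ≤ t} ≤ K / 2 ^ n * t ^ (R + 1) := by
  have hin := ae_mem_innerBox hsupp hcont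
  set m := estMass p J
  have hm : 0 < m := estMass_pos p J
  obtain ⟨q₁, hq₁⟩ := exists_nat_ge (2 / m)
  obtain ⟨q₂, hq₂⟩ := exists_pow_lt_of_lt_one hδ (by norm_num : (1 / 4 : ℝ) < 1)
  set q := max q₁ q₂ with hq
  have hqm : 2 ≤ q * m := by
    rw [div_le_iff₀ hm] at hq₁
    have : (q₁ : ℝ) ≤ q := by exact_mod_cast le_max_left _ _
    nlinarith
  set A : ℝ := 1 + 2 * k with hA
  have hA1 : 1 ≤ A := by simp [hA]
  have hA0 : 0 < A := by linarith
  -- Then $(A\delta)^r=4^{-qr}$, and $qm\ge 2$ gives $qr\ge n-q$. So this factor is at most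
  -- $4^{q-n}$, which turns $2^n$ into $2^{-n}$ up to a constant.
  set δ : ℝ := (1 / 4) ^ q / A with hδdef
  have hδ0 : 0 < δ := by positivity
  have hδ4 : δ ≤ (1 / 4) ^ q := div_le_self (by positivity) hA1
  have hδ1 : δ ≤ 1 := hδ4.trans (pow_le_one₀ (by norm_num) (by norm_num))
  have hAδ : A * δ = (1 / 4) ^ q := by rw [hδdef]; field_simp
  refine ⟨δ, 3 ^ (2 * k) * 4 ^ q / δ ^ (2 * k + R + 1), hδ0,
    hδ4.trans ((pow_le_pow_of_le_one (by norm_num) (by norm_num) (le_max_right q₁ q₂)).trans hq₂.le),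
    by positivity, ?_⟩
  obtain ⟨n₀, hn₀⟩ := exists_nat_ge ((2 * l + 2 * (2 * k + R + 2)) / m)
  filter_upwards [eventually_ge_atTop n₀] with n hn t ht0 htδ
  have hnm : 2 * (l : ℝ) + 2 * (2 * k + R + 2) ≤ n * m := by
    rw [div_le_iff₀ hm] at hn₀
    have : (n₀ : ℝ) ≤ n := by exact_mod_cast hn
    nlinarith
  set r := ⌊(n : ℝ) * m / 2⌋₊ with hr
  have hr1 : (r : ℝ) ≤ n * m / 2 := Nat.floor_le (by positivity)
  have hr2 : (n : ℝ) * m / 2 < r + 1 := Nat.lt_floor_add_one _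
  have hl0 : (0 : ℝ) ≤ l := Nat.cast_nonneg l
  have hrR : 2 * k + R + 1 ≤ r := by
    have : ((2 * k + R + 1 : ℕ) : ℝ) < (r : ℝ) + 1 := by push_cast; linarith
    have : 2 * k + R + 1 < r + 1 := by exact_mod_cast this
    omega
  have hnq : n ≤ q * r + q := by
    have : (n : ℝ) ≤ q * r + q := by
      have : (q : ℝ) * (n * m / 2) ≤ q * (r + 1) := by gcongr
      nlinarith [(Nat.cast_nonneg n : (0 : ℝ) ≤ n)]
    exact_mod_cast this
  obtain ⟨bad, -, hbp, hbad⟩ := exists_small_box_event (μ := μ) (n := n) hcont ht0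
    (htδ.trans hδ1) r
  have hle : (sampleLaw μ n).real {x | trueMass a b p μ x J ≤ t} ≤ (sampleLaw μ n).real bad := by
    refine ENNReal.toReal_mono (measure_ne_top _ _) (measure_mono_ae ?_)
    filter_upwards [ae_generic hsupp hcont n] with x hx hxt
    by_contra hxb
    have hbox : IsHBox (region a b p x J ∩ innerBox a b) :=
      isHBox_region_inter_innerBox a b p x (by rw [length_of_mem_cells hJ]; exact hl)
    have h := hbad x hxb _ hbox (by rw [real_inter_innerBox hin]; exact hxt)
    rw [cnt_inter_innerBox hx] at h
    have hN := (abs_le.1 (abs_card_members_sub_le hx p hl hJ)).1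
    change _ ≤ cnt x (region a b p x J) - n * m at hN
    linarith
  refine hle.trans (hbp.trans ?_)
  obtain ⟨e, he⟩ := Nat.exists_eq_add_of_le hrR
  have h1 : (A * t) ^ r * δ ^ (2 * k + R + 1) ≤ (A * δ) ^ r * t ^ (2 * k + R + 1) := by
    generalize 2 * k + R + 1 = d at he
    rw [mul_pow, mul_pow, he, pow_add t, pow_add δ]
    have : t ^ e ≤ δ ^ e := by gcongr
    calc A ^ (d + e) * (t ^ d * t ^ e) * δ ^ d = A ^ (d + e) * t ^ d * δ ^ d * t ^ e := by ring
      _ ≤ A ^ (d + e) * t ^ d * δ ^ d * δ ^ e := by gcongr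
      _ = _ := by ring
  have h2 : (A * δ) ^ r * 4 ^ n ≤ 4 ^ q := by
    rw [hAδ, ← pow_mul, one_div, inv_pow, inv_mul_le_iff₀ (by positivity), ← pow_add]
    exact pow_le_pow_right₀ (by norm_num) (by linarith)
  have h4 : (4 : ℝ) ^ n = 2 ^ n * 2 ^ n := by rw [← mul_pow]; norm_num
  have e1 : 3 ^ (2 * k) * 4 ^ q / δ ^ (2 * k + R + 1) / 2 ^ n * t ^ (R + 1) =
      (3 / t) ^ (2 * k) * (4 ^ q / 2 ^ n * (t ^ (2 * k + R + 1) / δ ^ (2 * k + R + 1))) := by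
    have haux : (3 / t) ^ (2 * k) * t ^ (2 * k + R + 1) = 3 ^ (2 * k) * t ^ (R + 1) := by
      rw [div_pow, add_assoc (2 * k) R 1, pow_add t (2 * k), ← mul_assoc,
        div_mul_cancel₀ _ (by positivity)]
    calc _ = 3 ^ (2 * k) * t ^ (R + 1) * (4 ^ q / δ ^ (2 * k + R + 1) / 2 ^ n) := by
          simp only [div_eq_mul_inv]; ac_rfl
      _ = _ := by rw [← haux]; simp only [div_eq_mul_inv]; ac_rfl
  rw [e1]
  refine mul_le_mul_of_nonneg_left ?_ (by positivity)
  rw [div_mul_div_comm, le_div_iff₀ (by positivity)]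
  calc 2 ^ n * (A * t) ^ r * (2 ^ n * δ ^ (2 * k + R + 1))
      = 4 ^ n * ((A * t) ^ r * δ ^ (2 * k + R + 1)) := by rw [h4]; ring
    _ ≤ 4 ^ n * ((A * δ) ^ r * t ^ (2 * k + R + 1)) := by gcongr
    _ = ((A * δ) ^ r * 4 ^ n) * t ^ (2 * k + R + 1) := by ring
    _ ≤ 4 ^ q * t ^ (2 * k + R + 1) := by gcongr

/-- A negative moment near `0` from a power bound for the distribution function. -/
theorem lintegral_inv_pow_le {Ω : Type*} [MeasurableSpace Ω] (P : Measure Ω) [IsFiniteMeasure P]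
    {M : Ω → ℝ} (hM : Measurable M) {δ K : ℝ} (hδ : 0 < δ) (hK : 0 ≤ K) (R : ℕ)
    (hP : ∀ t, 0 < t → t ≤ δ → P.real {ω | M ω ≤ t} ≤ K * t ^ (R + 1)) :
    ∫⁻ ω, ENNReal.ofReal ({ω | 0 < M ω ∧ M ω ≤ δ}.indicator (fun ω => (M ω)⁻¹ ^ R) ω) ∂P ≤
      ENNReal.ofReal (K * (2 ^ (R + 1) * δ)) := by
  -- Dyadic shells $\delta 2^{-(j+1)}<M\le\delta 2^{-j}$. The spare power of $t$ in the tail bound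
  -- makes their contributions geometric.
  have hpt : ∀ ω, ENNReal.ofReal ({ω | 0 < M ω ∧ M ω ≤ δ}.indicator (fun ω => (M ω)⁻¹ ^ R) ω) ≤
      ∑' j : ℕ, {ω | M ω ≤ δ * (1 / 2) ^ j}.indicator
        (fun _ => ENNReal.ofReal ((δ * (1 / 2) ^ (j + 1))⁻¹ ^ R)) ω := by
    intro ω
    by_cases hω : 0 < M ω ∧ M ω ≤ δ
    · rw [Set.indicator_of_mem (show ω ∈ {ω | 0 < M ω ∧ M ω ≤ δ} from hω)]
      obtain ⟨j, hj1, hj2⟩ := exists_nat_pow_near_of_lt_one (x := M ω / δ) (y := (1 / 2 : ℝ))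
        (div_pos hω.1 hδ) ((div_le_one hδ).2 hω.2) (by norm_num) (by norm_num)
      rw [lt_div_iff₀' hδ] at hj1
      rw [div_le_iff₀' hδ] at hj2
      refine le_trans ?_ (ENNReal.le_tsum j)
      rw [Set.indicator_of_mem (show ω ∈ {ω | M ω ≤ δ * (1 / 2) ^ j} from hj2)]
      apply ENNReal.ofReal_le_ofReal
      have : 0 ≤ (M ω)⁻¹ := inv_nonneg.2 hω.1.le
      gcongr
    · rw [Set.indicator_of_notMem (show ω ∉ {ω | 0 < M ω ∧ M ω ≤ δ} from hω)]
      simp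
  refine (lintegral_mono hpt).trans ?_
  rw [lintegral_tsum fun j => (measurable_const.indicator
    (measurableSet_le hM measurable_const)).aemeasurable]
  have hterm : ∀ j : ℕ, ∫⁻ ω, {ω | M ω ≤ δ * (1 / 2) ^ j}.indicator
      (fun _ => ENNReal.ofReal ((δ * (1 / 2) ^ (j + 1))⁻¹ ^ R)) ω ∂P ≤
      ENNReal.ofReal (K * (2 ^ R * δ) * (1 / 2) ^ j) := by
    intro j
    rw [lintegral_indicator_const (measurableSet_le hM measurable_const),
      ← ofReal_measureReal, ← ENNReal.ofReal_mul (by positivity)]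
    apply ENNReal.ofReal_le_ofReal
    have h := hP (δ * (1 / 2) ^ j) (by positivity)
      (mul_le_of_le_one_right hδ.le (pow_le_one₀ (by norm_num) (by norm_num)))
    calc (δ * (1 / 2) ^ (j + 1))⁻¹ ^ R * P.real {ω | M ω ≤ δ * (1 / 2) ^ j}
        ≤ (δ * (1 / 2) ^ (j + 1))⁻¹ ^ R * (K * (δ * (1 / 2) ^ j) ^ (R + 1)) := by gcongr
      _ = K * (2 ^ R * δ) * (1 / 2) ^ j := by
        have e : (δ * (1 / 2) ^ (j + 1) : ℝ)⁻¹ = 2 * (δ * (1 / 2) ^ j)⁻¹ := by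
          rw [pow_succ]; field_simp
        have hne : δ * (1 / 2 : ℝ) ^ j ≠ 0 := by positivity
        rw [e, mul_pow, pow_succ (δ * (1 / 2) ^ j), inv_pow]
        field_simp
  calc ∑' j : ℕ, ∫⁻ ω, {ω | M ω ≤ δ * (1 / 2) ^ j}.indicator
        (fun _ => ENNReal.ofReal ((δ * (1 / 2) ^ (j + 1))⁻¹ ^ R)) ω ∂P
      ≤ ∑' j : ℕ, ENNReal.ofReal (K * (2 ^ R * δ) * (1 / 2) ^ j) := ENNReal.tsum_le_tsum hterm
    _ = ENNReal.ofReal (∑' j : ℕ, K * (2 ^ R * δ) * (1 / 2) ^ j) :=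
        (ENNReal.ofReal_tsum_of_nonneg (fun j => by positivity)
          (summable_geometric_two.mul_left _)).symm
    _ = ENNReal.ofReal (K * (2 ^ (R + 1) * δ)) := by
        rw [tsum_mul_left, tsum_geometric_two]; ring_nf

theorem ae_pos_of_lower_tail {Ω : Type*} [MeasurableSpace Ω] (P : Measure Ω) [IsFiniteMeasure P]
    {M : Ω → ℝ} {δ K : ℝ} (hδ : 0 < δ) (R : ℕ)
    (hP : ∀ t, 0 < t → t ≤ δ → P.real {ω | M ω ≤ t} ≤ K * t ^ (R + 1)) : ∀ᵐ ω ∂P, 0 < M ω := by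
  have h0 : P.real {ω | M ω ≤ 0} ≤ 0 := by
    have hlim : Tendsto (fun t : ℝ => K * t ^ (R + 1)) (nhdsWithin 0 (Set.Ioi 0)) (nhds 0) := by
      have : Tendsto (fun t : ℝ => K * t ^ (R + 1)) (nhds 0) (nhds (K * 0 ^ (R + 1))) :=
        (continuous_const.mul (continuous_pow _)).tendsto 0
      rw [zero_pow (by omega), mul_zero] at this
      exact this.mono_left nhdsWithin_le_nhds
    refine ge_of_tendsto hlim ?_
    filter_upwards [Ioc_mem_nhdsGT hδ] with t ht
    exact (measureReal_mono fun ω hω => le_trans hω ht.1.le).trans (hP t ht.1 ht.2)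
  rw [ae_iff]
  simp only [not_lt]
  exact (measureReal_eq_zero_iff).1 (le_antisymm h0 measureReal_nonneg)

end LowerTail

/-! ### The function `f` -/

section Generator

variable {f : ℝ → ℝ}

theorem abs_le_mul_of_deriv_bound {g : ℝ → ℝ} {t D : ℝ} (h1 : g 1 = 0)
    (hd : ∀ s ∈ Set.uIcc 1 t, DifferentiableAt ℝ g s) (hD : ∀ s ∈ Set.uIcc 1 t, |deriv g s| ≤ D) :
    |g t| ≤ D * |t - 1| := by
  have := Convex.norm_image_sub_le_of_norm_deriv_le hd hD (convex_uIcc 1 t) Set.left_mem_uIcc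
    Set.right_mem_uIcc
  simpa [h1] using this

/-- The mean value inequality is applied in turn to $f''-1$, $f'-(t-1)$ and $f-(t-1)^2/2$, all of
which vanish at $1$. No continuity of $f'''$ is needed, and the lost factor $1/6$ is immaterial. -/
theorem exists_taylor_bound (hf0 : f 1 = 0) (hf1 : deriv f 1 = 0) (hf2 : iteratedDeriv 2 f 1 = 1)
    (hdiff : ∀ i < 3, ∀ t : ℝ, 0 < t → DifferentiableAt ℝ (iteratedDeriv i f) t)
    (hbdd : ∀ ε : ℝ, 0 < ε → ∃ B : ℝ, ∀ t : ℝ, ε ≤ t → |iteratedDeriv 3 f t| ≤ B)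
    {ε : ℝ} (hε : 0 < ε) (hε1 : ε ≤ 1) :
    ∃ B : ℝ, 0 ≤ B ∧ ∀ t, ε ≤ t → |f t - (t - 1) ^ 2 / 2| ≤ B * |t - 1| ^ 3 := by
  obtain ⟨B, hB⟩ := hbdd ε hε
  have hge : ∀ {t s}, ε ≤ t → s ∈ Set.uIcc 1 t → ε ≤ s := fun ht hs =>
    (le_min hε1 ht).trans hs.1
  have hab : ∀ {t s : ℝ}, s ∈ Set.uIcc 1 t → |s - 1| ≤ |t - 1| := fun hs => by
    have := Set.abs_sub_left_of_mem_uIcc hs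
    simpa [abs_sub_comm] using this
  have hB0 : 0 ≤ B := (abs_nonneg _).trans (hB ε le_rfl)
  have d0 : ∀ s, 0 < s → DifferentiableAt ℝ f s := fun s hs => by
    simpa using hdiff 0 (by norm_num) s hs
  have d1 : ∀ s, 0 < s → DifferentiableAt ℝ (deriv f) s := fun s hs => by
    simpa [iteratedDeriv_one] using hdiff 1 (by norm_num) s hs
  have d2 : ∀ s, 0 < s → DifferentiableAt ℝ (iteratedDeriv 2 f) s := hdiff 2 (by norm_num)
  have e3 : ∀ s, deriv (iteratedDeriv 2 f) s = iteratedDeriv 3 f s := fun s => by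
    rw [iteratedDeriv_succ (n := 2)]
  have e2 : ∀ s, deriv (deriv f) s = iteratedDeriv 2 f s := fun s => by
    rw [iteratedDeriv_succ, iteratedDeriv_one]
  have b2 : ∀ t, ε ≤ t → |iteratedDeriv 2 f t - 1| ≤ B * |t - 1| := fun t ht =>
    abs_le_mul_of_deriv_bound (g := fun s => iteratedDeriv 2 f s - 1) (by simp [hf2])
      (fun s hs => (d2 s (hε.trans_le (hge ht hs))).sub_const 1) (fun s hs => by
        rw [deriv_sub_const, e3]
        exact hB s (hge ht hs))
  have b1 : ∀ t, ε ≤ t → |deriv f t - (t - 1)| ≤ B * |t - 1| * |t - 1| := fun t ht =>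
    abs_le_mul_of_deriv_bound (g := fun s => deriv f s - (s - 1)) (by simp [hf1])
      (fun s hs => (d1 s (hε.trans_le (hge ht hs))).sub (by fun_prop)) (fun s hs => by
        rw [deriv_fun_sub (d1 s (hε.trans_le (hge ht hs))) (by fun_prop), e2]
        simp only [deriv_sub_const, deriv_id'']
        exact (b2 s (hge ht hs)).trans (mul_le_mul_of_nonneg_left (hab hs) hB0))
  refine ⟨B, hB0, fun t ht => ?_⟩
  have := abs_le_mul_of_deriv_bound (g := fun s => f s - (s - 1) ^ 2 / 2) (t := t)
    (D := B * |t - 1| * |t - 1|) (by simp [hf0])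
    (fun s hs => (d0 s (hε.trans_le (hge ht hs))).sub (by fun_prop)) (fun s hs => by
      rw [deriv_fun_sub (d0 s (hε.trans_le (hge ht hs))) (by fun_prop)]
      have : deriv (fun s : ℝ => (s - 1) ^ 2 / 2) s = s - 1 := by
        have h : HasDerivAt (fun s : ℝ => (s - 1) ^ 2 / 2) (2 * (s - 1) ^ (2 - 1) * 1 / 2) s := by
          exact (((hasDerivAt_id s).sub_const 1).pow 2).div_const 2
        rw [h.deriv]; ring
      rw [this]
      refine (b1 s (hge ht hs)).trans ?_
      have := hab hs
      gcongr)
  refine this.trans (le_of_eq ?_)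
  ring

/-- The tangent at $1$ is the zero line. -/
theorem nonneg_of_convexOn (hconv : ConvexOn ℝ (Set.Ioi 0) f) (hf0 : f 1 = 0)
    (hf1 : deriv f 1 = 0) (hd : DifferentiableAt ℝ f 1) {t : ℝ} (ht : 0 < t) : 0 ≤ f t := by
  have h1 : (1 : ℝ) ∈ Set.Ioi 0 := by simp
  rcases lt_trichotomy t 1 with h | h | h
  · have := hconv.slope_le_deriv ht h1 h hd
    rw [hf1, slope_def_field, hf0, div_le_iff₀ (by linarith)] at this
    linarith
  · rw [h, hf0]
  · have := hconv.deriv_le_slope h1 ht h hd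
    rw [hf1, slope_def_field, hf0, le_div_iff₀ (by linarith)] at this
    linarith

theorem antitone_of_convexOn (hconv : ConvexOn ℝ (Set.Ioi 0) f) (hf0 : f 1 = 0)
    (hf1 : deriv f 1 = 0) (hd : DifferentiableAt ℝ f 1) {u v : ℝ} (hu : 0 < u) (huv : u ≤ v)
    (hv : v ≤ 1) : f v ≤ f u := by
  have := hconv.le_max_of_mem_Icc (x := u) (y := 1) (z := v) hu (by simp) ⟨huv, hv⟩
  rwa [hf0, max_eq_left (nonneg_of_convexOn hconv hf0 hf1 hd hu)] at this

/-- Nothing is known of $f$ outside $(0,\infty)$; the truncation suffices because true masses are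
almost surely positive for large $n$. -/
theorem measurable_indicator_of_differentiableAt
    (hd : ∀ t : ℝ, 0 < t → DifferentiableAt ℝ f t) :
    Measurable ((Set.Ioi (0 : ℝ)).indicator f) := by
  classical
  have := ContinuousOn.measurable_piecewise (s := Set.Ioi (0 : ℝ)) (f := f) (g := 0)
    (fun t ht => (hd t ht).continuousAt.continuousWithinAt) continuousOn_const measurableSet_Ioi
  rwa [Set.piecewise_eq_indicator] at this

end Generator

/-! ### Growth of `f` at `0` -/

section Growth

variable {k : ℕ} {μ : Measure (Fin k → ℝ)} [IsProbabilityMeasure μ] {a b : Fin k → EReal}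
  {f : ℝ → ℝ}

theorem region_cons_subset {n : ℕ} (a b : Fin k → EReal) (p : List ℕ → ℕ)
    (x : Fin n → Fin k → ℝ) (s : ℕ) (J : List ℕ) :
    region a b p x (s :: J) ⊆ region a b p x J := fun _ hy => hy.1

theorem exists_extension (a b : Fin k → EReal) (p : List ℕ → ℕ) {j : ℕ} {J : List ℕ}
    (hJ : J ∈ cells p j) (d : ℕ) : ∃ K ∈ cells p (j + d), ∀ n, ∀ x : Fin n → Fin k → ℝ,
      region a b p x K ⊆ region a b p x J := by
  induction d with
  | zero => exact ⟨J, hJ, fun _ _ => subset_rfl⟩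
  | succ d ih =>
    obtain ⟨K, hK, h⟩ := ih
    exact ⟨0 :: K, mem_cells_succ.2 ⟨K, hK, 0, Nat.zero_le _, rfl⟩, fun n x =>
      (region_cons_subset a b p x 0 K).trans (h n x)⟩

/-- The condition $p_J\ge 1$ ensures that the first piece ends at an order statistic, hence at most
at $c$, or at the lower end point, when it is null. -/
theorem real_region_zero_le (hsupp : ∀ᵐ y ∂μ, y ∈ box a b)
    (hcont : ∀ (i : Fin k) (t : ℝ), μ {y | y i = t} = 0) (p : List ℕ → ℕ) {J : List ℕ}
    (hJ : J.length < k) (hp : 1 ≤ p J) {n : ℕ} (x : Fin n → Fin k → ℝ) (c : ℝ)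
    (hc : ∀ τ, x τ ⟨J.length, hJ⟩ ≤ c) :
    μ.real (region a b p x (0 :: J)) ≤ μ.real (halfSpace ⟨J.length, hJ⟩ c) := by
  set i : Fin k := ⟨J.length, hJ⟩ with hi
  rw [region_cons a b p x 0 hJ, ← hi]
  generalize hS : members x (region a b p x J) = S
  have hsub : ∀ c', region a b p x J ∩ (halfSpace i c' \ halfSpace i
      (cutPoint (a i) (b i) (fun τ => x τ i) S (p J) 0)) ⊆ halfSpace i c' := fun _ _ hy => hy.2.1
  refine (measureReal_mono (hsub _)).trans ?_
  rw [cutPoint, if_neg (by omega)]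
  split_ifs with h0
  · have : μ.real (halfSpace i (a i)) = 0 := by
      rw [measureReal_eq_zero_iff]
      refine measure_mono_null (t := (innerBox a b)ᶜ) ?_ (ae_mem_innerBox hsupp hcont)
      exact fun y hy hy' => absurd (hy' i).1 (not_lt.2 hy)
    rw [this]; exact measureReal_nonneg
  · refine measureReal_mono (halfSpace_mono (EReal.coe_le_coe_iff.2 ?_))
    have hr : S.card * (0 + 1) / (p J + 1) ≤ S.card := by
      rw [zero_add, mul_one]; exact Nat.div_le_self _ _
    rw [orderStat_le_iff (Nat.one_le_iff_ne_zero.2 h0) hr, Finset.filter_true_of_mem fun τ _ => hc τ]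
    exact hr

/-- If all $n$ points lie in a half space of mass $um$, some final region has mass at most $um$, and
its loss is at least $m f(u)$. Nonnegativity of the other terms gives $(um)^n\,m f(u)\le$ risk. -/
theorem exists_growth_bound (hsupp : ∀ᵐ y ∂μ, y ∈ box a b)
    (hcont : ∀ (i : Fin k) (t : ℝ), μ {y | y i = t} = 0) {l : ℕ} (hl : l ≤ k) (p : List ℕ → ℕ)
    (hnn : ∀ t, 0 < t → 0 ≤ f t) (hanti : ∀ u v, 0 < u → u ≤ v → v ≤ 1 → f v ≤ f u)
    {j : ℕ} (hj : j < l) {J : List ℕ} (hJ : J ∈ cells p j) (hp : 1 ≤ p J) {n : ℕ}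
    (hpos : ∀ᵐ x ∂(sampleLaw μ n), ∀ K ∈ cells p l, 0 < trueMass a b p μ x K)
    (hint : Integrable (loss (n := n) f a b p l μ) (sampleLaw μ n)) :
    ∃ C : ℝ, 0 ≤ C ∧ ∀ u, 0 < u → u < 1 → f u ≤ C * u⁻¹ ^ n := by
  have hlen := length_of_mem_cells hJ
  have hJk : J.length < k := by omega
  obtain ⟨K, hK, hKsub⟩ := exists_extension a b p
    (mem_cells_succ.2 ⟨J, hJ, 0, Nat.zero_le _, rfl⟩) (l - (j + 1))
  rw [show j + 1 + (l - (j + 1)) = l by omega] at hK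
  set m := estMass p K with hm
  have hm0 : 0 < m := estMass_pos p K
  have hm1 : m ≤ 1 := estMass_le_one p K
  set i : Fin k := ⟨J.length, hJk⟩ with hi
  have hterm : ∀ᵐ x ∂(sampleLaw μ n), ∀ L ∈ cells p l,
      0 ≤ estMass p L * f (trueMass a b p μ x L / estMass p L) := by
    filter_upwards [hpos] with x hx L hL
    exact mul_nonneg (estMass_pos p L).le (hnn _ (div_pos (hx L hL) (estMass_pos p L)))
  have hloss0 : 0 ≤ ∫ x, loss f a b p l μ x ∂(sampleLaw μ n) := by
    refine integral_nonneg_of_ae ?_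
    filter_upwards [hterm] with x hx
    exact Finset.sum_nonneg hx
  refine ⟨(∫ x, loss f a b p l μ x ∂(sampleLaw μ n)) / m ^ (n + 1), by positivity, ?_⟩
  intro u hu0 hu1
  have hum : u * m < 1 := by nlinarith
  obtain ⟨c, hc⟩ := exists_real_inter_halfSpace_eq hcont i Set.univ (θ := u * m) (by positivity)
    (by rw [probReal_univ]; exact hum.le)
  rw [Set.univ_inter] at hc
  -- Infinite levels are excluded because $0<um<1$.
  have hcr : ∃ r : ℝ, (r : EReal) = c := by
    induction c with
    | bot => simp [halfSpace] at hc; rcases hc with h | h <;> linarith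
    | top => simp [halfSpace] at hc; linarith
    | coe r => exact ⟨r, rfl⟩
  obtain ⟨r, rfl⟩ := hcr
  set E : Set (Fin n → Fin k → ℝ) := Set.univ.pi fun _ => halfSpace i r with hE
  have hEm : MeasurableSet E := MeasurableSet.univ_pi fun _ => measurableSet_halfSpace i r
  have hPE : (sampleLaw μ n).real E = (u * m) ^ n := by
    rw [measureReal_def, sampleLaw, hE, Measure.pi_pi]
    simp only [Finset.prod_const, Finset.card_univ, Fintype.card_fin, ENNReal.toReal_pow]
    rw [← measureReal_def, hc]
  have hle : ∫ x, E.indicator (fun _ => m * f u) x ∂(sampleLaw μ n) ≤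
      ∫ x, loss f a b p l μ x ∂(sampleLaw μ n) := by
    refine integral_mono_ae ((integrable_const _).indicator hEm) hint ?_
    filter_upwards [hpos, hterm] with x hx hx'
    by_cases hxE : x ∈ E
    · rw [Set.indicator_of_mem hxE]
      refine le_trans ?_ (Finset.single_le_sum hx' hK)
      refine mul_le_mul_of_nonneg_left (hanti _ _ (div_pos (hx K hK) hm0) ?_ hu1.le) hm0.le
      rw [div_le_iff₀ hm0, ← hc]
      exact (measureReal_mono (hKsub n x)).trans (real_region_zero_le hsupp hcont p hJk hp x r
        fun τ => EReal.coe_le_coe_iff.1 (hxE τ (Set.mem_univ _)))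
    · rw [Set.indicator_of_notMem hxE]
      exact Finset.sum_nonneg hx'
  rw [integral_indicator_const _ hEm, hPE, smul_eq_mul] at hle
  rw [div_mul_eq_mul_div, le_div_iff₀ (by positivity), inv_pow, ← div_eq_mul_inv,
    le_div_iff₀ (by positivity)]
  calc f u * m ^ (n + 1) * u ^ n = (u * m) ^ n * (m * f u) := by rw [mul_pow]; ring
    _ ≤ _ := hle

/-- When nothing is split, finite risk says nothing about $f$ near $0$, so the growth argument
fails; but then the loss is identically $0$. -/
theorem trivial_partition (hin : ∀ᵐ y ∂μ, y ∈ innerBox a b) {l : ℕ} (hl : l ≤ k)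
    (p : List ℕ → ℕ) (hp : ∀ j < l, ∀ J ∈ cells p j, p J = 0) :
    (cells p l).card = 1 ∧ ∀ J ∈ cells p l, estMass p J = 1 ∧
      ∀ n, ∀ x : Fin n → Fin k → ℝ, trueMass a b p μ x J = 1 := by
  have h : (cells p l).card = 1 ∧ ∀ J ∈ cells p l, estMass p J = 1 ∧
      ∀ n, ∀ x : Fin n → Fin k → ℝ, innerBox a b ⊆ region a b p x J := by
    induction l with
    | zero =>
      refine ⟨by simp [cells], fun J hJ => ?_⟩
      simp only [cells, Finset.mem_singleton] at hJ
      subst hJ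
      exact ⟨rfl, fun n x y hy i => ⟨(hy i).1.le, (hy i).2⟩⟩
    | succ l ih =>
      obtain ⟨h1, h2⟩ := ih (by omega) fun j hj => hp j (by omega)
      obtain ⟨K, hK⟩ := Finset.card_eq_one.1 h1
      have hpK : p K = 0 := hp l (by omega) K (by simp [hK])
      refine ⟨by simp [cells, hK, hpK], fun J hJ => ?_⟩
      obtain ⟨K', hK', s, hs, rfl⟩ := mem_cells_succ.1 hJ
      have hlen := length_of_mem_cells hK'
      have hKk : K'.length < k := by omega
      have hpK' : p K' = 0 := hp l (by omega) K' hK'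
      obtain ⟨h3, h4⟩ := h2 K' hK'
      obtain rfl : s = 0 := by omega
      refine ⟨by simp [estMass, h3, hpK'], fun n x y hy => ?_⟩
      rw [region_cons a b p x 0 hKk]
      refine ⟨h4 n x hy, ?_, ?_⟩
      · simpa [cutPoint, hpK', halfSpace] using (hy ⟨K'.length, hKk⟩).2
      · simpa [cutPoint, hpK', halfSpace] using (hy ⟨K'.length, hKk⟩).1
  refine ⟨h.1, fun J hJ => ⟨(h.2 J hJ).1, fun n x => ?_⟩⟩
  refine le_antisymm measureReal_le_one ?_
  have : μ.real (innerBox a b) = 1 := by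
    simpa using real_inter_innerBox hin Set.univ
  rw [← this]
  exact measureReal_mono ((h.2 J hJ).2 n x)

end Growth

/-! ### The asymptotic risk -/

/-- Here $y\approx-(M-m)$, and $(M-m)^2-y^2=((M-m)+y)((M-m)-y)$ is of order $z^{-10}z^{-7}$. The
cubic Taylor error is of order $z^{-21}$. -/
theorem abs_div_sub_sq_le {f : ℝ → ℝ} {B m ε C z M y : ℝ} (hm : 0 < m)
    (hB0 : 0 ≤ B) (hB : ∀ t, ε ≤ t → |f t - (t - 1) ^ 2 / 2| ≤ B * |t - 1| ^ 3) (hz : 1 ≤ z)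
    (hM : ε ≤ M / m) (h1 : |M - m| ≤ C / z ^ 7) (h2 : |(M - m) + y| ≤ C / z ^ 10) :
    |f (M / m) - y ^ 2 / (2 * m ^ 2)| ≤ (B * C ^ 3 / m ^ 3 + 3 * C ^ 2 / (2 * m ^ 2)) / z ^ 17 := by
  have hz0 : 0 < z := by linarith
  have hC : 0 ≤ C := by
    have := (abs_nonneg _).trans h1
    rwa [le_div_iff₀ (by positivity), zero_mul] at this
  have e1 : |M / m - 1| = |M - m| / m := by
    rw [div_sub_one hm.ne', abs_div, abs_of_pos hm]
  have t1 : |f (M / m) - (M - m) ^ 2 / (2 * m ^ 2)| ≤ B * C ^ 3 / m ^ 3 / z ^ 17 := by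
    have h := hB _ hM
    rw [e1, show (M / m - 1) ^ 2 / 2 = (M - m) ^ 2 / (2 * m ^ 2) by field_simp] at h
    refine h.trans ?_
    calc B * (|M - m| / m) ^ 3 ≤ B * (C / z ^ 7 / m) ^ 3 := by gcongr
      _ = B * C ^ 3 / m ^ 3 / z ^ 21 := by field_simp
      _ ≤ B * C ^ 3 / m ^ 3 / z ^ 17 := by gcongr; norm_num
  have t2 : |(M - m) ^ 2 - y ^ 2| ≤ 3 * C ^ 2 / z ^ 17 := by
    have e : (M - m) ^ 2 - y ^ 2 = ((M - m) + y) * (2 * (M - m) - ((M - m) + y)) := by ring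
    have h3 : C / z ^ 10 ≤ C / z ^ 7 := by gcongr; norm_num
    have h4 : |2 * (M - m) - ((M - m) + y)| ≤ 3 * (C / z ^ 7) := by
      refine (abs_sub _ _).trans ?_
      rw [abs_mul, abs_two]
      linarith
    rw [e, abs_mul]
    calc _ ≤ C / z ^ 10 * (3 * (C / z ^ 7)) := by gcongr
      _ = 3 * C ^ 2 / z ^ 17 := by field_simp
  have t3 : |(M - m) ^ 2 / (2 * m ^ 2) - y ^ 2 / (2 * m ^ 2)| ≤ 3 * C ^ 2 / (2 * m ^ 2) / z ^ 17 := by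
    rw [← sub_div, abs_div, abs_of_pos (by positivity : 0 < 2 * m ^ 2), div_le_iff₀ (by positivity)]
    refine t2.trans (le_of_eq ?_)
    field_simp
  rw [add_div]
  exact (abs_sub_le _ _ _).trans (add_le_add t1 t3)

section Risk

variable {k : ℕ} {μ : Measure (Fin k → ℝ)} [IsProbabilityMeasure μ] {a b : Fin k → EReal}
  {f : ℝ → ℝ}

theorem eventually_inv_two_pow_le : ∀ᶠ n : ℕ in atTop, 1 / (2 : ℝ) ^ n ≤ 1 / scale n ^ 17 := by
  have h := (tendsto_pow_const_div_const_pow_of_one_lt 2 (by norm_num : (1 : ℝ) < 2)).eventually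
    (ge_mem_nhds zero_lt_one)
  filter_upwards [h, tendsto_scale.eventually_ge_atTop 1] with n hn hz
  rw [div_le_one (by positivity), ← scale_pow n, ← pow_mul] at hn
  exact one_div_le_one_div_of_le (by positivity)
    ((pow_le_pow_right₀ hz (by norm_num)).trans hn)

/-- The quadratic proxy $Y^2/(2m^2)$ has exact mean $(1-m)/(2mn)$ by the binomial variance. It
remains to bound the expected difference from $f(\hat m/m)$. -/
theorem cell_asymptotics (hsupp : ∀ᵐ y ∂μ, y ∈ box a b)
    (hcont : ∀ (i : Fin k) (t : ℝ), μ {y | y i = t} = 0) {l : ℕ} (hl : l ≤ k) (p : List ℕ → ℕ)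
    (hnn : ∀ t, 0 < t → 0 ≤ f t) (hmeas : Measurable ((Set.Ioi (0 : ℝ)).indicator f))
    (htay : ∀ ε : ℝ, 0 < ε → ε ≤ 1 → ∃ B : ℝ, 0 ≤ B ∧
      ∀ t, ε ≤ t → |f t - (t - 1) ^ 2 / 2| ≤ B * |t - 1| ^ 3)
    {R : ℕ} {C : ℝ} (hC : 0 ≤ C) (hgrow : ∀ u, 0 < u → u < 1 → f u ≤ C * u⁻¹ ^ R)
    {J : List ℕ} (hJ : J ∈ cells p l) : ∃ K : ℝ, ∀ᶠ n : ℕ in atTop,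
      Integrable (fun x => f (trueMass a b p μ x J / estMass p J)) (sampleLaw μ n) ∧
      |∫ x, f (trueMass a b p μ x J / estMass p J) ∂(sampleLaw μ n) -
        (1 - estMass p J) / (2 * estMass p J * n)| ≤ K / scale n ^ 17 := by
  set m := estMass p J with hmdef
  have hm0 : 0 < m := estMass_pos p J
  have hm1 : m ≤ 1 := estMass_le_one p J
  have hpop : MeasurableSet (popCell μ p J) :=
    measurableSet_popCell μ p (by rw [length_of_mem_cells hJ]; exact hl)
  obtain ⟨δ, K₁, hδ0, hδm, hK₁, htail⟩ := exists_lower_tail_bound hsupp hcont hl p hJ R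
    (half_pos hm0)
  obtain ⟨C₀, hC₀, hgood⟩ := exists_good_event hsupp hcont hl p
  obtain ⟨B, hB0, hB⟩ := htay (δ / m) (by positivity) (by rw [div_le_one hm0]; linarith)
  set K₂ := B * C₀ ^ 3 / m ^ 3 + 3 * C₀ ^ 2 / (2 * m ^ 2) with hK₂
  set K₃ := 1 / m ^ 2 + B / m ^ 3 + 1 / (2 * m ^ 2) with hK₃
  have hK₃0 : 0 ≤ K₃ := by positivity
  set K₄ := C * m ^ R * (K₁ * (2 ^ (R + 1) * δ)) with hK₄
  have hK₄0 : 0 ≤ K₄ := by positivity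
  have hsmall : ∀ᶠ n : ℕ in atTop, C₀ / scale n ^ 7 < m / 2 := by
    have h7 : Tendsto (fun n => scale n ^ 7) atTop atTop :=
      (tendsto_pow_atTop (by norm_num)).comp tendsto_scale
    exact (h7.const_div_atTop C₀).eventually (gt_mem_nhds (half_pos hm0))
  refine ⟨K₂ + K₃ + K₄, ?_⟩
  filter_upwards [htail, hgood, hsmall, eventually_inv_two_pow_le, eventually_gt_atTop 0,
    tendsto_scale.eventually_ge_atTop 1] with n htail hgood hsmall htwo hn hz
  obtain ⟨bad, hbm, hbp, hgood⟩ := hgood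
  set z := scale n
  set P := sampleLaw μ n with hP
  have hMm : Measurable fun x : Fin n → Fin k → ℝ => trueMass a b p μ x J :=
    measurable_trueMass a b p μ hl hJ
  have hpos : ∀ᵐ x ∂P, 0 < trueMass a b p μ x J := ae_pos_of_lower_tail P hδ0 R htail
  have hlint := lintegral_inv_pow_le P hMm hδ0 (K := K₁ / 2 ^ n) (by positivity) R htail
  set T : (Fin n → Fin k → ℝ) → ℝ := {x | 0 < trueMass a b p μ x J ∧
    trueMass a b p μ x J ≤ δ}.indicator (fun x => (trueMass a b p μ x J)⁻¹ ^ R) with hT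
  have hTm : Measurable T := (hMm.inv.pow_const R).indicator
    ((measurableSet_lt measurable_const hMm).inter (measurableSet_le hMm measurable_const))
  have hT0 : ∀ x, 0 ≤ T x := fun x => Set.indicator_nonneg (fun x hx => by
    have := hx.1; positivity) x
  have hTi : Integrable T P := ⟨hTm.aestronglyMeasurable, by
    rw [hasFiniteIntegral_iff_ofReal (Eventually.of_forall hT0)]
    exact hlint.trans_lt ENNReal.ofReal_lt_top⟩
  have hTint : ∫ x, T x ∂P ≤ K₁ / 2 ^ n * (2 ^ (R + 1) * δ) := by
    rw [integral_eq_lintegral_of_nonneg_ae (Eventually.of_forall hT0) hTm.aestronglyMeasurable]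
    exact ENNReal.toReal_le_of_le_ofReal (by positivity) hlint
  set Y : (Fin n → Fin k → ℝ) → ℝ := fun x => cnt x (popCell μ p J) / n - m with hY
  have hYm : Measurable Y := ((measurable_cnt hpop).div_const _).sub_const _
  have hn' : (0 : ℝ) < n := by exact_mod_cast hn
  have hY1 : ∀ x, Y x ^ 2 ≤ 1 := fun x => by
    have h1 : 0 ≤ cnt x (popCell μ p J) / n := by unfold cnt; positivity
    have h2 : cnt x (popCell μ p J) / n ≤ 1 := by
      rw [div_le_one hn']
      have := Finset.card_le_univ (members x (popCell μ p J))
      rw [Fintype.card_fin] at this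
      exact Nat.cast_le.2 this
    rw [sq_le_one_iff_abs_le_one, abs_le]
    constructor <;> simp only [hY] <;> linarith
  have hY2 : Integrable (fun x => Y x ^ 2 / (2 * m ^ 2)) P :=
    Integrable.div_const (Integrable.of_bound (hYm.pow_const 2).aestronglyMeasurable 1
      (Eventually.of_forall fun x => by
        rw [Real.norm_of_nonneg (sq_nonneg _)]; exact hY1 x)) _
  have hYint : ∫ x, Y x ^ 2 / (2 * m ^ 2) ∂P = (1 - m) / (2 * m * n) := by
    rw [integral_div]
    have := integral_cnt_div_sub_sq (μ := μ) hpop hn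
    rw [real_popCell hcont p hl hJ] at this
    rw [this, ← hmdef]
    field_simp
  -- Three error sources: Taylor and localization on the good event; a bounded loss on the bad event
  -- when the mass exceeds $\delta$; the negative power $T$ when it does not.
  have hbound : ∀ᵐ x ∂P, ‖f (trueMass a b p μ x J / m) - Y x ^ 2 / (2 * m ^ 2)‖ ≤
      K₂ / z ^ 17 + K₃ * bad.indicator (fun _ => 1) x + C * m ^ R * T x := by
    filter_upwards [hpos, ae_generic hsupp hcont n] with x hx hgen
    rw [Real.norm_eq_abs]
    have hK₂z : 0 ≤ K₂ / z ^ 17 := by positivity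
    have hTx : 0 ≤ C * m ^ R * T x := mul_nonneg (by positivity) (hT0 x)
    by_cases hxb : x ∈ bad
    · rw [Set.indicator_of_mem hxb, mul_one]
      have hfx := hnn _ (div_pos hx hm0)
      have hYx : Y x ^ 2 / (2 * m ^ 2) ≤ 1 / (2 * m ^ 2) := by gcongr; exact hY1 x
      have hYx0 : 0 ≤ Y x ^ 2 / (2 * m ^ 2) := by positivity
      suffices h : f (trueMass a b p μ x J / m) ≤ 1 / m ^ 2 + B / m ^ 3 + C * m ^ R * T x by
        have : |f (trueMass a b p μ x J / m) - Y x ^ 2 / (2 * m ^ 2)| ≤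
            f (trueMass a b p μ x J / m) + 1 / (2 * m ^ 2) := by
          rw [abs_le]; constructor <;> linarith
        linarith
      rcases le_or_gt (trueMass a b p μ x J) δ with hle | hlt
      · have hTe : T x = (trueMass a b p μ x J)⁻¹ ^ R :=
          Set.indicator_of_mem (s := {x | 0 < trueMass a b p μ x J ∧ trueMass a b p μ x J ≤ δ})
            ⟨hx, hle⟩ _
        have := hgrow _ (div_pos hx hm0) (by rw [div_lt_one hm0]; linarith)
        rw [inv_div, div_eq_mul_inv m, mul_pow, ← hTe] at this
        have h1 : 0 ≤ 1 / m ^ 2 + B / m ^ 3 := by positivity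
        rw [mul_assoc]
        linarith
      · have h := (abs_le.1 (hB _ ((div_le_div_iff_of_pos_right hm0).2 hlt.le))).2
        have hM1 : trueMass a b p μ x J ≤ 1 := measureReal_le_one
        have hab : |trueMass a b p μ x J / m - 1| ≤ 1 / m := by
          rw [div_sub_one hm0.ne', abs_div, abs_of_pos hm0]
          gcongr
          rw [abs_le]; constructor <;> linarith
        have h3 : B * |trueMass a b p μ x J / m - 1| ^ 3 ≤ B / m ^ 3 := by
          calc _ ≤ B * (1 / m) ^ 3 := by gcongr
            _ = B / m ^ 3 := by rw [one_div, inv_pow, div_eq_mul_inv]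
        have h2 : (trueMass a b p μ x J / m - 1) ^ 2 / 2 ≤ 1 / m ^ 2 := by
          have : (trueMass a b p μ x J / m - 1) ^ 2 ≤ (1 / m) ^ 2 := by
            rw [← sq_abs]; gcongr
          rw [div_pow, one_pow] at this
          have : 0 ≤ (trueMass a b p μ x J / m - 1) ^ 2 := sq_nonneg _
          linarith
        linarith
    · rw [Set.indicator_of_notMem hxb, mul_zero, add_zero]
      obtain ⟨g1, g2⟩ := hgood x hxb hgen J hJ
      -- On the good event $|M-m|<m/2$, and $\delta\le m/2$ by choice.
      have hMδ : δ ≤ trueMass a b p μ x J := by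
        have := (abs_le.1 g1).1
        linarith
      have := abs_div_sub_sq_le (f := f) hm0 hB0 hB hz
        ((div_le_div_iff_of_pos_right hm0).2 hMδ) g1 g2
      linarith
  have hi₁ : Integrable (fun x => K₃ * bad.indicator (fun _ => (1 : ℝ)) x) P :=
    ((integrable_const (1 : ℝ)).indicator hbm).const_mul _
  have hi₂ : Integrable (fun x => K₂ / z ^ 17 + K₃ * bad.indicator (fun _ => (1 : ℝ)) x) P :=
    (integrable_const _).add hi₁
  have hbi : Integrable (fun x => K₂ / z ^ 17 + K₃ * bad.indicator (fun _ => (1 : ℝ)) x +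
      C * m ^ R * T x) P := hi₂.add (hTi.const_mul _)
  have hfm : AEStronglyMeasurable (fun x => f (trueMass a b p μ x J / m)) P := by
    refine AEStronglyMeasurable.congr (f := fun x => (Set.Ioi (0 : ℝ)).indicator f
      (trueMass a b p μ x J / m)) (hmeas.comp (hMm.div_const m)).aestronglyMeasurable ?_
    filter_upwards [hpos] with x hx
    exact Set.indicator_of_mem (div_pos hx hm0) _
  have hdi : Integrable (fun x => f (trueMass a b p μ x J / m) - Y x ^ 2 / (2 * m ^ 2)) P :=
    hbi.mono' (hfm.sub hY2.aestronglyMeasurable) hbound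
  have hfi : Integrable (fun x => f (trueMass a b p μ x J / m)) P := by
    refine (hdi.add hY2).congr (Eventually.of_forall fun x => ?_)
    simp
  refine ⟨hfi, ?_⟩
  rw [← hYint, ← integral_sub hfi hY2, ← Real.norm_eq_abs]
  refine (norm_integral_le_of_norm_le hbi hbound).trans ?_
  rw [integral_add hi₂ (hTi.const_mul _), integral_add (integrable_const _) hi₁, integral_const_mul,
    integral_const_mul, integral_indicator_const _ hbm, integral_const, probReal_univ, one_smul,
    smul_eq_mul, mul_one]
  have h1 : K₃ * P.real bad ≤ K₃ / z ^ 17 := by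
    rw [div_eq_mul_one_div]; exact mul_le_mul_of_nonneg_left hbp hK₃0
  have h2 : C * m ^ R * ∫ x, T x ∂P ≤ K₄ / z ^ 17 := by
    calc C * m ^ R * ∫ x, T x ∂P ≤ C * m ^ R * (K₁ / 2 ^ n * (2 ^ (R + 1) * δ)) := by gcongr
      _ = K₄ * (1 / 2 ^ n) := by rw [hK₄]; ring
      _ ≤ K₄ * (1 / z ^ 17) := by gcongr
      _ = K₄ / z ^ 17 := by ring
  have h3 : (K₂ + K₃ + K₄) / z ^ 17 = K₂ / z ^ 17 + K₃ / z ^ 17 + K₄ / z ^ 17 := by ring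
  rw [h3]
  exact add_le_add (add_le_add le_rfl h1) h2

theorem isLittleO_div_scale (K : ℝ) {g : ℕ → ℝ}
    (hg : ∀ᶠ n : ℕ in atTop, |g n| ≤ K / scale n ^ 17) : g =o[atTop] fun n : ℕ => 1 / (n : ℝ) := by
  have h1 : (fun n : ℕ => K / scale n ^ 17) =o[atTop] fun n : ℕ => 1 / (n : ℝ) := by
    have hlim : Tendsto (fun n : ℕ => K / scale n) atTop (nhds 0) := tendsto_scale.const_div_atTop K
    have h2 : (fun n : ℕ => K / scale n) =o[atTop] fun _ : ℕ => (1 : ℝ) :=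
      (isLittleO_one_iff ℝ).2 hlim
    have h3 := h2.mul_isBigO (isBigO_refl (fun n : ℕ => 1 / (n : ℝ)) atTop)
    refine (h3.congr (fun n => ?_) (fun n => one_mul _))
    -- $z^{17}=z\cdot n$, so the error is $1/n$ times a null sequence.
    rw [← scale_pow n, div_mul_div_comm, mul_one, ← pow_succ']
  refine IsBigO.trans_isLittleO (IsBigO.of_bound 1 ?_) h1
  filter_upwards [hg] with n hn
  rw [one_mul]
  exact hn.trans (le_abs_self _)

end Risk

end MovingRegion

/-! ### The main theorem -/

theorem theorem3 {k : ℕ} (a b : Fin k → EReal) (μ : Measure (Fin k → ℝ)) [IsProbabilityMeasure μ]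
    (hsupp : ∀ᵐ y ∂μ, y ∈ MovingRegion.box a b)
    (hcont : ∀ (i : Fin k) (t : ℝ), μ {y | y i = t} = 0)
    (l : ℕ) (hl : l ≤ k) (p : List ℕ → ℕ)
    (f : ℝ → ℝ) (hconv : ConvexOn ℝ (Set.Ioi 0) f)
    (hf0 : f 1 = 0) (hf1 : deriv f 1 = 0) (hf2 : iteratedDeriv 2 f 1 = 1)
    (hdiff : ∀ i < 3, ∀ t : ℝ, 0 < t → DifferentiableAt ℝ (iteratedDeriv i f) t)
    (hbdd : ∀ ε : ℝ, 0 < ε → ∃ B : ℝ, ∀ t : ℝ, ε ≤ t → |iteratedDeriv 3 f t| ≤ B)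
    (hfin : ∃ᶠ n : ℕ in atTop,
      Integrable (MovingRegion.loss (n := n) f a b p l μ) (MovingRegion.sampleLaw μ n)) :
    (∀ᶠ n : ℕ in atTop,
      Integrable (MovingRegion.loss (n := n) f a b p l μ) (MovingRegion.sampleLaw μ n)) ∧
    (fun n : ℕ => MovingRegion.risk f a b p l μ n -
        (((MovingRegion.cells p l).card : ℝ) - 1) / (2 * (n : ℝ)))
      =o[atTop] (fun n : ℕ => 1 / (n : ℝ)) := by
  open MovingRegion in
  have hd0 : ∀ t : ℝ, 0 < t → DifferentiableAt ℝ f t := fun t ht => by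
    simpa using hdiff 0 (by norm_num) t ht
  have hnn : ∀ t, 0 < t → 0 ≤ f t := fun t ht =>
    nonneg_of_convexOn hconv hf0 hf1 (hd0 1 one_pos) ht
  by_cases hp : ∀ j < l, ∀ J ∈ cells p j, p J = 0
  · obtain ⟨hcard, hJ⟩ := trivial_partition (μ := μ) (ae_mem_innerBox hsupp hcont) hl p hp
    have hloss : ∀ n, loss (n := n) f a b p l μ = fun _ => 0 := fun n => by
      funext x
      refine Finset.sum_eq_zero fun J hJ' => ?_
      rw [(hJ J hJ').1, (hJ J hJ').2 n x, div_one, hf0, mul_zero]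
    refine ⟨Eventually.of_forall fun n => by rw [hloss n]; exact integrable_zero _ _ _, ?_⟩
    simp only [risk, hloss, hcard, integral_zero, Nat.cast_one, sub_self, zero_div]
    exact isLittleO_zero _ _
  push Not at hp
  obtain ⟨j, hj, J₀, hJ₀, hpJ₀⟩ := hp
  have hposev : ∀ᶠ n : ℕ in atTop, ∀ᵐ x ∂(sampleLaw μ n), ∀ K ∈ cells p l,
      0 < trueMass a b p μ x K := by
    have : ∀ K ∈ cells p l, ∀ᶠ n : ℕ in atTop, ∀ᵐ x ∂(sampleLaw μ n),
        0 < trueMass a b p μ x K := fun K hK => by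
      obtain ⟨δ, K₁, hδ0, -, -, htail⟩ := exists_lower_tail_bound hsupp hcont hl p hK 0 one_pos
      filter_upwards [htail] with n hn
      exact ae_pos_of_lower_tail _ hδ0 0 hn
    filter_upwards [(Filter.eventually_all_finset _).2 this] with n hn
    exact (ae_ball_iff (cells p l).countable_toSet).2 hn
  -- A single sample size with finite risk and almost surely positive masses suffices; it fixes the
  -- growth exponent of $f$ for all larger $n$.
  obtain ⟨R, hRint, hRpos⟩ := (hfin.and_eventually hposev).exists
  obtain ⟨C, hC, hgrow⟩ := exists_growth_bound hsupp hcont hl p hnn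
    (fun u v hu huv hv => antitone_of_convexOn hconv hf0 hf1 (hd0 1 one_pos) hu huv hv) hj hJ₀
    (Nat.one_le_iff_ne_zero.2 hpJ₀) hRpos hRint
  have hcell : ∀ J : List ℕ, ∃ K : ℝ, J ∈ cells p l → ∀ᶠ n : ℕ in atTop,
      Integrable (fun x => f (trueMass a b p μ x J / estMass p J)) (sampleLaw μ n) ∧
      |∫ x, f (trueMass a b p μ x J / estMass p J) ∂(sampleLaw μ n) -
        (1 - estMass p J) / (2 * estMass p J * n)| ≤ K / scale n ^ 17 := fun J => by
    by_cases hJ : J ∈ cells p l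
    · obtain ⟨K, hK⟩ := cell_asymptotics hsupp hcont hl p hnn
        (measurable_indicator_of_differentiableAt hd0)
        (fun ε hε hε1 => exists_taylor_bound hf0 hf1 hf2 hdiff hbdd hε hε1) hC hgrow hJ
      exact ⟨K, fun _ => hK⟩
    · exact ⟨0, fun h => absurd h hJ⟩
  choose K hK using hcell
  have hall := (Filter.eventually_all_finset (cells p l)).2 hK
  refine ⟨?_, isLittleO_div_scale (∑ J ∈ cells p l, estMass p J * K J) ?_⟩
  · filter_upwards [hall] with n hn
    exact integrable_finsetSum _ fun J hJ => (hn J hJ).1.const_mul _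
  · filter_upwards [hall, eventually_gt_atTop 0] with n hn hn0
    have hn' : (n : ℝ) ≠ 0 := by exact_mod_cast hn0.ne'
    have hrisk : risk f a b p l μ n = ∑ J ∈ cells p l, estMass p J *
        ∫ x, f (trueMass a b p μ x J / estMass p J) ∂(sampleLaw μ n) := by
      simp only [risk, loss, fDiv]
      rw [integral_finsetSum _ fun J hJ => (hn J hJ).1.const_mul _]
      simp only [integral_const_mul]
    -- The weight $m_J$ cancels the $m_J$ in the denominator, and $\sum_J(1-m_J)$ is the number of
    -- regions minus one.
    have hmain : (((cells p l).card : ℝ) - 1) / (2 * (n : ℝ)) = ∑ J ∈ cells p l, estMass p J *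
        ((1 - estMass p J) / (2 * estMass p J * n)) := by
      have : ∀ J ∈ cells p l, estMass p J * ((1 - estMass p J) / (2 * estMass p J * n)) =
          (1 - estMass p J) / (2 * n) := fun J _ => by
        have := (estMass_pos p J).ne'
        field_simp
      rw [Finset.sum_congr rfl this, ← Finset.sum_div, Finset.sum_sub_distrib, sum_estMass]
      simp
    rw [hrisk, hmain, ← Finset.sum_sub_distrib, Finset.sum_div]
    refine (Finset.abs_sum_le_sum_abs _ _).trans (Finset.sum_le_sum fun J hJ => ?_)
    rw [← mul_sub, abs_mul, abs_of_pos (estMass_pos p J), mul_div_assoc]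
    exact mul_le_mul_of_nonneg_left (hn J hJ).2 (estMass_pos p J).le
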